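/- A (multi-edge) graph sequence adds at each step $n=1,2,\dots$ a finite set $G_n$ of undirected edges $\{u,v\}$ (loops allowed); the same edge may be added at several steps, at most once per step. Its step collection $C_N$ is the multiset consisting of the sets $A_e=\{n\le N : e\in G_n\}$, one for each distinct edge $e\in G_1\cup\dots\cup G_N$; $|A_e|$ is the multiplicity of $e$. Edges are treated as arbitrary labels, so the distribution of a random graph sequence means the law of $(C_N)_{N\ge 0}$. It is edge-exchangeable if for every $N$ the law of $C_N$ is invariant under all permutations of $\{1,\dots,N\}$. An edge-exchangeable graph sequence has an edge-exchangeable graph probability function (EGPF) if there is a function $p$, symmetric in its arguments after the first, such that for every $N$ and all non-empty $A_1,\dots,A_K\subseteq\{1,\dots,N\}$ $$\Pr\big(\tilde C_N=(A_1,\dots,A_K)\big)=p(N,|A_1|,\dots,|A_K|),$$ where $\tilde C_N$ is $C_N$ listed in uniformly random order, i.e. the left side is $\Pr(C_N=\{A_1,\dots,A_K\})$ (as multisets) divided by the number of distinct arrangements of the list $(A_1,\dots,A_K)$. Construction: let $\lambda\in[0,\infty)$ and $V_1,V_2,\dots\in[0,1]$ be random variables with an arbitrary joint law. Conditionally on $(\lambda,V_1,V_2,\dots)$,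 let $Z_{n,k}\sim\mathrm{Bernoulli}(V_k)$ and $U_n\sim\mathrm{Poisson}(\lambda)$ ($n,k\ge1$) all be independent. At step $n$, add the edge indexed by $k$ for each $k$ with $Z_{n,k}=1$, and add $U_n$ further edges; edges with different indices are distinct, and each of the further edges is different from all others and occurs at no other step. Only finitely many edges are added at each step, almost surely. Theorem. (i) For every joint law of $(\lambda,V_1,V_2,\dots)$ with $\sum_k V_k<\infty$ almost surely, such a graph sequence exists. (ii) Every random graph sequence generated by this construction is edge-exchangeable and has an EGPF. (iii) Conversely, every random graph sequence with an EGPF has the same distribution as one generated by this construction, for some joint law of $\lambda$ and $(V_k)_{k\ge1}$. -/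

import Mathlib

open MeasureTheory ProbabilityTheory
open scoped NNReal ENNReal unitInterval

/-- Collections (multisets) of subsets of the first `N` steps. -/
abbrev StepCollection (N : ℕ) : Type := Multiset (Finset (Fin N))

/-- `StepCollection N` is countable and carries the discrete σ-algebra. -/
instance instMeasurableSpaceStepCollection (N : ℕ) : MeasurableSpace (StepCollection N) := ⊤

instance instDiscreteMeasurableSpaceStepCollection (N : ℕ) :
    DiscreteMeasurableSpace (StepCollection N) := ⟨fun _ => trivial⟩

/-- A graph sequence on the node set `W`, given by its steps: `g n` is the finite set of the
(undirected, possibly loop) edges that are added at step `n = 0, 1, 2, …`. An edge occurs at most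
once per step, and may occur at several steps. -/
abbrev GraphSeq (W : Type*) : Type _ := ℕ → Finset (Sym2 W)

open Classical in
/-- The distinct edges that occur during the first `N` steps. -/
noncomputable def seenEdges {W : Type*} (g : GraphSeq W) (N : ℕ) : Finset (Sym2 W) :=
  (Finset.univ : Finset (Fin N)).biUnion fun n => g n

open Classical in
/-- The steps, among the first `N`, at which the edge `e` occurs. -/
noncomputable def occurrences {W : Type*} (g : GraphSeq W) (N : ℕ) (e : Sym2 W) :
    Finset (Fin N) :=
  Finset.univ.filter fun n => e ∈ g n

/-- The step collection after `N` steps: one set of steps for each distinct edge that has occurred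
(a multiset, as different edges may have occurred at exactly the same steps). -/
noncomputable def stepCollection {W : Type*} (g : GraphSeq W) (N : ℕ) : StepCollection N :=
  (seenEdges g N).val.map (occurrences g N)

/-- Permuting the steps in a step collection. -/
def StepCollection.permute {N : ℕ} (τ : Equiv.Perm (Fin N)) (c : StepCollection N) :
    StepCollection N :=
  c.map (Finset.map τ.toEmbedding)

/-- Edge-exchangeability of a random graph sequence: for every `N`, permuting the first `N` steps
does not change the law of the step collection. (`IdentDistrib` contains the measurability of the
step collections.) -/
def IsEdgeExchangeable {Ω W : Type*} [MeasurableSpace Ω] (μ : Measure Ω)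
    (G : Ω → GraphSeq W) : Prop :=
  ∀ (N : ℕ) (τ : Equiv.Perm (Fin N)),
    IdentDistrib (fun ω => stepCollection (G ω) N)
      (fun ω => (stepCollection (G ω) N).permute τ) μ μ

/-- The probability that the step collection after `N` steps, listed in a uniformly random order,
is the list `l`: given that the collection is the multiset underlying `l`, all the distinct
arrangements of `l` are equally likely. -/
noncomputable def orderedProb {Ω W : Type*} [MeasurableSpace Ω] (μ : Measure Ω)
    (G : Ω → GraphSeq W) (N : ℕ) (l : List (Finset (Fin N))) : ℝ :=
  μ.real {ω | stepCollection (G ω) N = (l : Multiset (Finset (Fin N)))} /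
    (l.permutations.toFinset.card : ℝ)

/-- An edge-exchangeable random graph sequence has an edge-exchangeable graph probability function
if the probability of its (uniformly ordered) step collection after `N` steps is a function of `N`
and of the edge multiplicities only, symmetric in the multiplicities. -/
def HasEGPF {Ω W : Type*} [MeasurableSpace Ω] (μ : Measure Ω) (G : Ω → GraphSeq W) : Prop :=
  IsEdgeExchangeable μ G ∧
    ∃ p : ℕ → List ℕ → ℝ,
      (∀ (N : ℕ) (m m' : List ℕ), m.Perm m' → p N m = p N m') ∧
      ∀ (N : ℕ) (l : List (Finset (Fin N))), (∀ A ∈ l, A.Nonempty) →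
        orderedProb μ G N l = p N (l.map Finset.card)

/-- The weight that the Bernoulli law with success probability `v` gives to `b`. -/
noncomputable def bernoulliWeight (v : I) (b : Bool) : ℝ≥0∞ :=
  ENNReal.ofReal (if b then (v : ℝ) else 1 - (v : ℝ))

/-- Conditionally on the rate `lam` and the frequencies `freq 0, freq 1, …`, all the indicators
`Z n k` and counts `U n` are independent, `Z n k` is Bernoulli with success probability `freq k`,
and `U n` is Poisson with mean `lam`. The joint law of `lam` and the frequencies is arbitrary. -/
structure IsBernoulliPoissonDraw {Ω : Type*} [MeasurableSpace Ω] (μ : Measure Ω)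
    (lam : Ω → ℝ≥0) (freq : Ω → ℕ → I) (Z : ℕ → ℕ → Ω → Bool) (U : ℕ → Ω → ℕ) : Prop where
  measurable_lam : Measurable lam
  measurable_freq : Measurable freq
  measurable_Z : ∀ n k, Measurable (Z n k)
  measurable_U : ∀ n, Measurable (U n)
  joint_law : ∀ (B : Set (ℝ≥0 × (ℕ → I))), MeasurableSet B →
    ∀ (N K : ℕ) (z : ℕ → ℕ → Bool) (u : ℕ → ℕ),
      μ {ω | (lam ω, freq ω) ∈ B ∧ ∀ n < N, (∀ k < K, Z n k ω = z n k) ∧ U n ω = u n} =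
        ∫⁻ ω in {ω | (lam ω, freq ω) ∈ B},
          ∏ n ∈ Finset.range N,
            ((∏ k ∈ Finset.range K, bernoulliWeight (freq ω k) (z n k)) *
              poissonMeasure (lam ω) {u n}) ∂μ

/-- The indices of the edges present at step `n`: `Sum.inl k` stands for the edge number `k` of the
frequency model, present if `z n k`; `Sum.inr (n, j)` with `j < u n` are the `u n` edges that are
specific to step `n`. -/
def presentAt (z : ℕ → ℕ → Bool) (u : ℕ → ℕ) (n : ℕ) : Set (ℕ ⊕ (ℕ × ℕ)) :=
  Sum.inl '' {k | z n k = true} ∪ Sum.inr '' {x | x.1 = n ∧ x.2 < u n}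

/-- The random graph sequence `G` is generated from the frequencies `freq` and the rate `lam`: at
each step `n`, the edge with index `k` is included with probability `freq k`, and a Poisson number
with mean `lam` of edges that occur at no other step is added. The (possibly random) map `lab`
tells which edge an index stands for; almost surely, it is injective on the indices that ever
occur. As `G` has finite steps, almost surely only finitely many edges are present at each step. -/
def IsFrequencyPoissonGraph {Ω W : Type*} [MeasurableSpace Ω] (μ : Measure Ω)
    (lam : Ω → ℝ≥0) (freq : Ω → ℕ → I) (G : Ω → GraphSeq W) : Prop :=
  ∃ (Z : ℕ → ℕ → Ω → Bool) (U : ℕ → Ω → ℕ) (lab : Ω → ℕ ⊕ (ℕ × ℕ) → Sym2 W),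
    IsBernoulliPoissonDraw μ lam freq Z U ∧
    ∀ᵐ ω ∂μ,
      Set.InjOn (lab ω) (⋃ n, presentAt (fun n k => Z n k ω) (fun n => U n ω) n) ∧
      ∀ n, (G ω n : Set (Sym2 W)) =
        lab ω '' presentAt (fun n k => Z n k ω) (fun n => U n ω) n

section Arrangements

variable {α β : Type*}

/-- The number of distinct lists with underlying multiset `c`. -/
noncomputable def arrangements [DecidableEq α] (c : Multiset α) : ℕ :=
  c.toList.permutations.toFinset.card

lemma List.Perm.toFinset_permutations_eq [DecidableEq α] {l l' : List α} (h : l.Perm l') :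
    l.permutations.toFinset = l'.permutations.toFinset := by
  ext x
  simp only [List.mem_toFinset, List.mem_permutations]
  exact ⟨fun hx => hx.trans h, fun hx => hx.trans h.symm⟩

lemma arrangements_coe [DecidableEq α] (l : List α) :
    arrangements (l : Multiset α) = l.permutations.toFinset.card := by
  rw [arrangements, List.Perm.toFinset_permutations_eq]
  exact Multiset.coe_eq_coe.1 (Multiset.coe_toList _)

lemma arrangements_pos [DecidableEq α] (c : Multiset α) : 0 < arrangements c :=
  Finset.card_pos.2 ⟨c.toList, by simp⟩

/-- A sum over lists of a function of the underlying multiset. -/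
lemma tsum_list_coe [DecidableEq α] (F : Multiset α → ℝ≥0∞) :
    ∑' l : List α, F l = ∑' c : Multiset α, arrangements c * F c := by
  rw [← (Equiv.sigmaFiberEquiv (fun l : List α => (l : Multiset α))).tsum_eq, ENNReal.tsum_sigma']
  refine tsum_congr fun c => ?_
  have h : ∀ x : {l : List α // (l : Multiset α) = c},
      F ((Equiv.sigmaFiberEquiv (fun l : List α => (l : Multiset α)) ⟨c, x⟩ : List α) :
        Multiset α) = F c := fun x => by
    simp [Equiv.sigmaFiberEquiv, x.2]
  simp_rw [h]
  have hs : ∀ l : List α, (l : Multiset α) = c ↔ l ∈ c.toList.permutations.toFinset := fun l => by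
    rw [List.mem_toFinset, List.mem_permutations, ← Multiset.coe_eq_coe, Multiset.coe_toList]
  rw [← (Equiv.subtypeEquivRight hs).symm.tsum_eq, tsum_fintype]
  simp [arrangements]

lemma tsum_list_eq_nil_add (F : List α → ℝ≥0∞) :
    ∑' l : List α, F l = F [] + ∑' a : α, ∑' l : List α, F (a :: l) := by
  let e : Unit ⊕ (α × List α) ≃ List α :=
    { toFun := Sum.elim (fun _ => []) fun x => x.1 :: x.2
      invFun := fun l => match l with
        | [] => .inl ()
        | a :: l => .inr (a, l)
      left_inv := by rintro (_ | _) <;> rfl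
      right_inv := by rintro (_ | _) <;> rfl }
  rw [← e.tsum_eq, Summable.tsum_sum (f := fun o => F (e o)) ENNReal.summable ENNReal.summable,
    ENNReal.tsum_prod']
  simp [e]

/-- The sum of a product weight over the lists with prescribed sequence of sizes. -/
lemma tsum_list_map_eq [Fintype α] [DecidableEq β] (f : α → β) (s : α → ℝ≥0∞) (m : List β) :
    ∑' l : List α, (if l.map f = m then (l.map s).prod else 0) =
      (m.map fun b => ∑ a with f a = b, s a).prod := by
  induction m with
  | nil => rw [tsum_list_eq_nil_add]; simp
  | cons b m ih =>
    rw [tsum_list_eq_nil_add]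
    simp only [List.map_nil, List.map_cons, List.prod_cons, List.cons.injEq, tsum_fintype]
    rw [Finset.sum_filter, ← ih, Finset.sum_mul]
    simp only [reduceCtorEq, if_false, zero_add]
    refine Finset.sum_congr rfl fun a _ => ?_
    rw [← ENNReal.tsum_mul_left]
    refine tsum_congr fun l => ?_
    by_cases h1 : f a = b <;> by_cases h2 : l.map f = m <;> simp [h1, h2]

lemma tsum_arrangements_map [Fintype α] [DecidableEq α] [DecidableEq β] (f : α → β)
    (s : α → ℝ≥0∞) (q : Multiset β → ℝ≥0∞) :
    ∑' c : Multiset α, arrangements c * (q (c.map f) * (c.map s).prod) =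
      ∑' m : Multiset β, arrangements m * (q m * (m.map fun b => ∑ a with f a = b, s a).prod) := by
  rw [← tsum_list_coe, ← tsum_list_coe]
  simp only [Multiset.map_coe, Multiset.prod_coe, ← tsum_list_map_eq, ← ENNReal.tsum_mul_left]
  rw [ENNReal.tsum_comm]
  refine tsum_congr fun l => ?_
  rw [tsum_eq_single (l.map f) (fun m hm => by simp [hm.symm])]
  simp

end Arrangements

section GeneratingFunction

variable {N : ℕ}

/-- The monomial of a step collection in the variables `s A`. -/
def StepCollection.weight (s : Finset (Fin N) → ℝ≥0) (c : StepCollection N) : ℝ≥0 :=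
  (c.map s).prod

/-- The average of `s` over the sets of steps of a given size. -/
noncomputable def sizeAverage (s : Finset (Fin N) → ℝ≥0) (j : ℕ) : ℝ≥0 :=
  (∑ B with B.card = j, s B) / (N.choose j : ℝ≥0)

lemma card_filter_card_eq (j : ℕ) :
    (Finset.univ.filter fun B : Finset (Fin N) => B.card = j).card = N.choose j := by
  rw [← Finset.powerset_univ, ← Finset.powersetCard_eq_filter, Finset.card_powersetCard]
  simp

lemma sum_sizeAverage (s : Finset (Fin N) → ℝ≥0) (j : ℕ) :
    ∑ B : Finset (Fin N) with B.card = j, sizeAverage s B.card =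
      ∑ B : Finset (Fin N) with B.card = j, s B := by
  rw [Finset.sum_congr rfl (g := fun _ => sizeAverage s j)
    (fun B hB => by rw [(Finset.mem_filter.1 hB).2]), Finset.sum_const, card_filter_card_eq,
    sizeAverage, nsmul_eq_mul]
  rcases Nat.eq_zero_or_pos (N.choose j) with h | h
  · have : (Finset.univ.filter fun B : Finset (Fin N) => B.card = j) = ∅ := by
      rw [← Finset.card_eq_zero, card_filter_card_eq, h]
    simp [h, this]
  · field_simp

lemma sizeAverage_le_one {s : Finset (Fin N) → ℝ≥0} (hs : ∀ A, s A ≤ 1) (j : ℕ) :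
    sizeAverage s j ≤ 1 := by
  refine div_le_one_of_le₀ ?_ zero_le
  refine (Finset.sum_le_sum fun B _ => hs B).trans ?_
  simp

lemma StepCollection.weight_le_one {s : Finset (Fin N) → ℝ≥0} (hs : ∀ A, s A ≤ 1)
    (c : StepCollection N) : c.weight s ≤ 1 := by
  induction c using Multiset.induction with
  | empty => simp [StepCollection.weight]
  | cons a c ih =>
    simp only [StepCollection.weight, Multiset.map_cons, Multiset.prod_cons] at ih ⊢
    exact mul_le_one' (hs a) ih

/-- A law on step collections has a probability function of the sizes, if the probability of
each arrangement depends on the sizes only. -/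
def DependsOnSizes (f : StepCollection N → ℝ≥0∞) : Prop :=
  ∃ q : Multiset ℕ → ℝ≥0∞, ∀ c, f c = arrangements c * q (c.map Finset.card)

lemma coe_weight (s : Finset (Fin N) → ℝ≥0) (c : StepCollection N) :
    (c.weight s : ℝ≥0∞) = (c.map fun A => (s A : ℝ≥0∞)).prod := by
  rw [StepCollection.weight]
  exact (map_multiset_prod ENNReal.ofNNRealHom _).trans (by rw [Multiset.map_map]; rfl)

lemma DependsOnSizes.tsum_weight {f : StepCollection N → ℝ≥0∞} (hf : DependsOnSizes f)
    (s : Finset (Fin N) → ℝ≥0) :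
    ∑' c, f c * c.weight s = ∑' c, f c * c.weight (fun A => sizeAverage s A.card) := by
  obtain ⟨q, hq⟩ := hf
  simp only [hq, coe_weight, mul_assoc]
  rw [tsum_arrangements_map, tsum_arrangements_map]
  simp only [← ENNReal.ofNNReal_finsetSum, sum_sizeAverage]

/-- The law of the step collection obtained by resampling each set of steps uniformly among
the sets of the same size. -/
noncomputable def resampled (f : StepCollection N → ℝ≥0∞) (c : StepCollection N) : ℝ≥0∞ :=
  arrangements c * ((∑' d : StepCollection N, if d.map Finset.card = c.map Finset.card then f d
    else 0) / (arrangements (c.map Finset.card) *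
      ((c.map Finset.card).map fun j => (N.choose j : ℝ≥0∞)).prod))

lemma dependsOnSizes_resampled (f : StepCollection N → ℝ≥0∞) : DependsOnSizes (resampled f) :=
  ⟨fun m => (∑' d : StepCollection N, if d.map Finset.card = m then f d else 0) /
    (arrangements m * (m.map fun j => (N.choose j : ℝ≥0∞)).prod), fun _ => rfl⟩

lemma tsum_resampled_weight (f : StepCollection N → ℝ≥0∞) (s : Finset (Fin N) → ℝ≥0) :
    ∑' c, resampled f c * c.weight s =
      ∑' c, f c * c.weight (fun A => sizeAverage s A.card) := by
  have key := tsum_arrangements_map (α := Finset (Fin N)) Finset.card (fun A => (s A : ℝ≥0∞))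
    (fun m => (∑' d : StepCollection N, if d.map Finset.card = m then f d else 0) /
      (arrangements m * (m.map fun j => (N.choose j : ℝ≥0∞)).prod))
  simp only [resampled, coe_weight, mul_assoc]
  rw [key]
  have step : ∀ m : Multiset ℕ, (arrangements m : ℝ≥0∞) *
      ((∑' d : StepCollection N, if d.map Finset.card = m then f d else 0) /
        (arrangements m * (m.map fun j => (N.choose j : ℝ≥0∞)).prod) *
        (m.map fun b => ∑ A : Finset (Fin N) with A.card = b, (s A : ℝ≥0∞)).prod) =
      ∑' d : StepCollection N, if d.map Finset.card = m then
        f d * (d.map fun A => (sizeAverage s A.card : ℝ≥0∞)).prod else 0 := by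
    intro m
    rw [ENNReal.div_eq_inv_mul, mul_comm _ (∑' d : StepCollection N, _), mul_assoc, mul_left_comm,
      ← ENNReal.tsum_mul_right]
    refine tsum_congr fun d => ?_
    split_ifs with h
    · subst h
      congr 1
      have h0 : (arrangements (d.map Finset.card) : ℝ≥0∞) ≠ 0 := by
        exact_mod_cast (arrangements_pos _).ne'
      rw [ENNReal.mul_inv (Or.inl h0) (Or.inl (ENNReal.natCast_ne_top _)), ← mul_assoc,
        ← mul_assoc, ENNReal.mul_inv_cancel h0 (ENNReal.natCast_ne_top _), one_mul]
      simp only [Multiset.map_map, Function.comp_def]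
      clear h0
      induction d using Multiset.induction with
      | empty => simp
      | cons A d ih =>
        have hc : (N.choose A.card : ℝ≥0∞) ≠ 0 := by
          have := Nat.choose_pos (show A.card ≤ N by simpa using A.card_le_univ)
          exact_mod_cast this.ne'
        have hc' : (N.choose A.card : ℝ≥0) ≠ 0 := by exact_mod_cast hc
        simp only [Multiset.map_cons, Multiset.prod_cons]
        rw [← ih, ENNReal.mul_inv (Or.inl hc) (Or.inl (ENNReal.natCast_ne_top _)), sizeAverage,
          ENNReal.coe_div hc', ENNReal.div_eq_inv_mul, ENNReal.ofNNReal_finsetSum,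
          ENNReal.coe_natCast]
        ring
    · simp
  simp_rw [step]
  rw [ENNReal.tsum_comm]
  refine tsum_congr fun d => ?_
  rw [tsum_eq_single (d.map Finset.card) (fun m hm => by simp [hm.symm])]
  simp

end GeneratingFunction

section Uniqueness

variable {N : ℕ}

instance instTopologicalSpaceStepCollection (N : ℕ) : TopologicalSpace (StepCollection N) := ⊥

instance instDiscreteTopologyStepCollection (N : ℕ) : DiscreteTopology (StepCollection N) := ⟨rfl⟩

instance instBorelSpaceStepCollection (N : ℕ) : BorelSpace (StepCollection N) :=
  ⟨by rw [borel_eq_top_of_discrete]; rfl⟩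

lemma StepCollection.weight_mul (s t : Finset (Fin N) → ℝ≥0) (c : StepCollection N) :
    c.weight s * c.weight t = c.weight (s * t) :=
  (Multiset.prod_map_mul).symm

/-- The monomial of a step collection as a bounded continuous function. -/
noncomputable def weightBCF (s : Finset (Fin N) → ℝ≥0) (hs : ∀ A, s A ≤ 1) :
    BoundedContinuousFunction (StepCollection N) ℝ :=
  BoundedContinuousFunction.ofNormedAddCommGroup (fun c => (c.weight s : ℝ))
    continuous_of_discreteTopology 1 fun c => by
      simpa using StepCollection.weight_le_one hs c

/-- The monomials form a submonoid of the bounded functions. -/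
noncomputable def weightSubmonoid (N : ℕ) :
    Submonoid (BoundedContinuousFunction (StepCollection N) ℝ) where
  carrier := {g | ∃ (s : Finset (Fin N) → ℝ≥0) (hs : ∀ A, s A ≤ 1), g = weightBCF s hs}
  one_mem' := ⟨1, fun _ => le_rfl, by ext c; simp [weightBCF, StepCollection.weight]⟩
  mul_mem' := by
    rintro _ _ ⟨s, hs, rfl⟩ ⟨t, ht, rfl⟩
    refine ⟨s * t, fun A => mul_le_one' (hs A) (ht A), ?_⟩
    ext c
    simp [weightBCF, ← StepCollection.weight_mul]

lemma integral_weight_eq (ν : Measure (StepCollection N)) (s : Finset (Fin N) → ℝ≥0) :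
    ∫ c, (c.weight s : ℝ) ∂ν = (∫⁻ c, c.weight s ∂ν).toReal := by
  rw [← integral_toReal (Measurable.of_discrete.aemeasurable) (by simp)]
  simp

/-- The expectations of the monomials determine the law of a step collection. -/
theorem ext_of_lintegral_weight {ν ν' : Measure (StepCollection N)} [IsFiniteMeasure ν]
    [IsFiniteMeasure ν']
    (h : ∀ s : Finset (Fin N) → ℝ≥0, (∀ A, s A ≤ 1) →
      ∫⁻ c, c.weight s ∂ν = ∫⁻ c, c.weight s ∂ν') : ν = ν' := by
  let A : StarSubalgebra ℝ (BoundedContinuousFunction (StepCollection N) ℝ) :=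
    { Algebra.adjoin ℝ (weightSubmonoid N : Set (BoundedContinuousFunction (StepCollection N) ℝ))
      with star_mem' := fun {g} hg => by
            have : star g = g := by ext c; simp
            rwa [this] }
  refine ext_of_forall_mem_subalgebra_integral_eq_of_polish (𝕜 := ℝ) (A := A) ?_ ?_
  · intro c d hcd
    obtain ⟨B, hB⟩ : ∃ B, c.count B ≠ d.count B := by
      by_contra! hne
      exact hcd (Multiset.ext.2 hne)
    let s : Finset (Fin N) → ℝ≥0 := fun B' => if B' = B then 2⁻¹ else 1
    have hs : ∀ A, s A ≤ 1 := fun A => by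
      by_cases hA : A = B
      · simp only [s, hA, if_true]
        exact inv_le_one_of_one_le₀ (by norm_num)
      · simp [s, hA]
    have hw : ∀ c : StepCollection N, c.weight s = 2⁻¹ ^ c.count B := fun c => by
      induction c using Multiset.induction with
      | empty => simp [StepCollection.weight]
      | cons A c ih =>
        simp only [StepCollection.weight, Multiset.map_cons, Multiset.prod_cons,
          Multiset.count_cons] at ih ⊢
        rw [ih]
        by_cases hA : A = B
        · simp [s, hA, pow_succ, mul_comm]
        · simp [s, hA, Ne.symm hA]
    refine ⟨weightBCF s hs, ⟨weightBCF s hs, ⟨weightBCF s hs,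
      Algebra.subset_adjoin ⟨s, hs, rfl⟩, rfl⟩, rfl⟩, ?_⟩
    simp only [weightBCF, BoundedContinuousFunction.coe_ofNormedAddCommGroup, hw]
    intro heq
    have h2 : ((2 : ℝ≥0)⁻¹) ^ c.count B = 2⁻¹ ^ d.count B := by exact_mod_cast heq
    rw [inv_pow, inv_pow, inv_inj] at h2
    exact hB (Nat.pow_right_injective le_rfl (by exact_mod_cast h2))
  · intro g hg
    have hg' : g ∈ Submodule.span ℝ
        (weightSubmonoid N : Set (BoundedContinuousFunction (StepCollection N) ℝ)) := by
      have := Algebra.adjoin_eq_span ℝ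
        (weightSubmonoid N : Set (BoundedContinuousFunction (StepCollection N) ℝ))
      rw [Submonoid.closure_eq] at this
      rw [← this]
      exact hg
    clear hg
    induction hg' using Submodule.span_induction with
    | mem g hg =>
      obtain ⟨s, hs, rfl⟩ := hg
      have := h s hs
      simp only [weightBCF, BoundedContinuousFunction.coe_ofNormedAddCommGroup,
        integral_weight_eq, this]
    | zero => simp
    | add f g hf hg ihf ihg =>
      simp only [BoundedContinuousFunction.coe_add, Pi.add_apply]
      rw [integral_add (f.integrable _) (g.integrable _),
        integral_add (f.integrable _) (g.integrable _), ihf, ihg]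
    | smul a g hg ihg =>
      simp only [BoundedContinuousFunction.coe_smul]
      rw [integral_smul, integral_smul, ihg]

lemma lintegral_weight_eq_tsum (ν : Measure (StepCollection N)) (s : Finset (Fin N) → ℝ≥0) :
    ∫⁻ c, c.weight s ∂ν = ∑' c, ν {c} * c.weight s := by
  rw [lintegral_countable']
  simp_rw [mul_comm]

/-- A law has a probability function of the sizes if and only if averaging the variables over the
sets of steps of the same size does not change its generating function. -/
theorem dependsOnSizes_iff (ν : Measure (StepCollection N)) [IsProbabilityMeasure ν] :
    DependsOnSizes (fun c => ν {c}) ↔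
      ∀ s : Finset (Fin N) → ℝ≥0, (∀ A, s A ≤ 1) →
        ∫⁻ c, c.weight s ∂ν = ∫⁻ c, c.weight (fun A => sizeAverage s A.card) ∂ν := by
  refine ⟨fun h s _ => ?_, fun h => ?_⟩
  · simp only [lintegral_weight_eq_tsum]
    exact h.tsum_weight s
  · let Q : Measure (StepCollection N) :=
      Measure.sum fun c => resampled (fun c => ν {c}) c • Measure.dirac c
    have hQ : ∀ c, Q {c} = resampled (fun c => ν {c}) c := fun c =>
      Measure.sum_smul_dirac_singleton
    have hw : ∀ s : Finset (Fin N) → ℝ≥0, ∫⁻ c, c.weight s ∂Q =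
        ∫⁻ c, c.weight (fun A => sizeAverage s A.card) ∂ν := fun s => by
      simp only [lintegral_weight_eq_tsum, hQ, tsum_resampled_weight]
    have hfin : IsFiniteMeasure Q := ⟨by
      have h1 := hw 1
      rw [lintegral_congr (g := fun _ => 1)
        (fun c => by simp [StepCollection.weight]), lintegral_one] at h1
      rw [h1]
      refine lt_of_le_of_lt (lintegral_mono (g := fun _ => 1) fun c => ?_) (by simp)
      exact ENNReal.coe_le_one_iff.2 (StepCollection.weight_le_one
        (fun A => sizeAverage_le_one (fun _ => le_rfl) A.card) c)⟩
    have heq : ν = Q := ext_of_lintegral_weight fun s hs => by rw [hw, h s hs]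
    have : (fun c => ν {c}) = resampled (fun c => ν {c}) := by
      ext c
      rw [← hQ, ← heq]
    rw [this]
    exact dependsOnSizes_resampled _

end Uniqueness

section EGPF

variable {Ω W : Type*} [MeasurableSpace Ω] {μ : Measure Ω} {G : Ω → GraphSeq W}

lemma nonempty_of_mem_stepCollection {g : GraphSeq W} {N : ℕ} {A : Finset (Fin N)}
    (hA : A ∈ stepCollection g N) : A.Nonempty := by
  classical
  simp only [stepCollection, Multiset.mem_map, Finset.mem_val, seenEdges, Finset.mem_biUnion,
    Finset.mem_univ, true_and] at hA
  obtain ⟨e, ⟨n, hn⟩, rfl⟩ := hA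
  exact ⟨n, by simpa [occurrences] using hn⟩

lemma IsEdgeExchangeable.aemeasurable (h : IsEdgeExchangeable μ G) (N : ℕ) :
    AEMeasurable (fun ω => stepCollection (G ω) N) μ :=
  (h N 1).aemeasurable_fst

lemma map_stepCollection_singleton {N : ℕ}
    (h : AEMeasurable (fun ω => stepCollection (G ω) N) μ) (c : StepCollection N) :
    μ.map (fun ω => stepCollection (G ω) N) {c} = μ {ω | stepCollection (G ω) N = c} := by
  rw [Measure.map_apply_of_aemeasurable h (MeasurableSet.singleton c)]
  rfl

lemma HasEGPF.dependsOnSizes [IsProbabilityMeasure μ] (h : HasEGPF μ G) (N : ℕ) :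
    DependsOnSizes fun c => μ.map (fun ω => stepCollection (G ω) N) {c} := by
  obtain ⟨hex, p, hp, hpl⟩ := h
  refine ⟨fun m => if 0 ∈ m then 0 else ENNReal.ofReal (p N m.toList), fun c => ?_⟩
  simp only [map_stepCollection_singleton (hex.aemeasurable N)]
  by_cases h0 : ∅ ∈ c
  · have : {ω | stepCollection (G ω) N = c} = ∅ := by
      ext ω
      simp only [Set.mem_ofPred_eq, Set.mem_empty_iff_false, iff_false]
      rintro rfl
      exact Finset.not_nonempty_empty (nonempty_of_mem_stepCollection h0)
    rw [this]
    simp [h0]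
  · have h0' : ¬ (0 ∈ c.map Finset.card) := by simpa using h0
    have hc := hpl N c.toList fun A hA => by
      rw [Finset.nonempty_iff_ne_empty]
      rintro rfl
      exact h0 (Multiset.mem_toList.1 hA)
    have hperm : (c.toList.map Finset.card).Perm (c.map Finset.card).toList := by
      rw [← Multiset.coe_eq_coe, Multiset.coe_toList, ← Multiset.map_coe, Multiset.coe_toList]
    have hpos : (0 : ℝ) < arrangements c := by exact_mod_cast arrangements_pos c
    rw [hp N _ _ hperm, orderedProb, Multiset.coe_toList] at hc
    change _ / (arrangements c : ℝ) = _ at hc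
    rw [if_neg h0', ← hc, ENNReal.ofReal_div_of_pos hpos, ofReal_measureReal,
      ENNReal.ofReal_natCast, ENNReal.mul_div_cancel]
    · exact_mod_cast (arrangements_pos c).ne'
    · exact ENNReal.natCast_ne_top _

lemma StepCollection.weight_permute {N : ℕ} (τ : Equiv.Perm (Fin N)) (s : Finset (Fin N) → ℝ≥0)
    (c : StepCollection N) :
    (c.permute τ).weight s = c.weight fun A => s (A.map τ.toEmbedding) := by
  simp [StepCollection.permute, StepCollection.weight]

lemma sizeAverage_map_perm {N : ℕ} (τ : Equiv.Perm (Fin N)) (s : Finset (Fin N) → ℝ≥0) (j : ℕ) :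
    sizeAverage (fun A => s (A.map τ.toEmbedding)) j = sizeAverage s j := by
  unfold sizeAverage
  congr 1
  refine Finset.sum_equiv τ.finsetCongr (fun A => by simp) fun A _ => by simp

/-- Random graph sequences whose generating functions are invariant under averaging over the sets
of steps of the same size are edge-exchangeable with an EGPF. -/
theorem hasEGPF_of_lintegral_weight [IsProbabilityMeasure μ]
    (hm : ∀ N, AEMeasurable (fun ω => stepCollection (G ω) N) μ)
    (h : ∀ (N : ℕ) (s : Finset (Fin N) → ℝ≥0), (∀ A, s A ≤ 1) →
      ∫⁻ ω, (stepCollection (G ω) N).weight s ∂μ =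
        ∫⁻ ω, (stepCollection (G ω) N).weight (fun A => sizeAverage s A.card) ∂μ) :
    HasEGPF μ G := by
  have hprob : ∀ N, IsProbabilityMeasure (μ.map (fun ω => stepCollection (G ω) N)) := fun N =>
    Measure.isProbabilityMeasure_map (hm N)
  have hmap : ∀ N (f : StepCollection N → ℝ≥0∞),
      ∫⁻ c, f c ∂(μ.map (fun ω => stepCollection (G ω) N)) =
        ∫⁻ ω, f (stepCollection (G ω) N) ∂μ := fun N f =>
    lintegral_map' Measurable.of_discrete.aemeasurable (hm N)
  refine ⟨fun N τ => ⟨hm N, Measurable.of_discrete.comp_aemeasurable (hm N), ?_⟩, ?_⟩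
  · have h2 : μ.map (fun ω => (stepCollection (G ω) N).permute τ) =
        (μ.map (fun ω => stepCollection (G ω) N)).map (StepCollection.permute τ) :=
      (AEMeasurable.map_map_of_aemeasurable Measurable.of_discrete.aemeasurable (hm N)).symm
    have : IsProbabilityMeasure (μ.map (fun ω => (stepCollection (G ω) N).permute τ)) :=
      Measure.isProbabilityMeasure_map (Measurable.of_discrete.comp_aemeasurable (hm N))
    refine ext_of_lintegral_weight fun s hs => ?_
    rw [h2, hmap, lintegral_map Measurable.of_discrete Measurable.of_discrete, hmap, h N s hs]
    simp only [StepCollection.weight_permute]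
    rw [h N _ fun A => hs _]
    simp only [sizeAverage_map_perm]
  · have hd : ∀ N, DependsOnSizes fun c => μ.map (fun ω => stepCollection (G ω) N) {c} :=
      fun N => (dependsOnSizes_iff _).2 fun s hs => by rw [hmap, hmap, h N s hs]
    choose q hq using hd
    beta_reduce at hq
    refine ⟨fun N m => (q N m).toReal, fun N m m' hmm => ?_, fun N l _ => ?_⟩
    · simp only [Multiset.coe_eq_coe.2 hmm]
    · have hpos : (0 : ℝ) < arrangements (l : Multiset (Finset (Fin N))) := by
        exact_mod_cast arrangements_pos _
      rw [orderedProb, measureReal_def, ← map_stepCollection_singleton (hm N), hq,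
        ← arrangements_coe, ENNReal.toReal_mul, ENNReal.toReal_natCast, mul_comm,
        mul_div_assoc, div_self hpos.ne', mul_one, Multiset.map_coe]

end EGPF

section ConditionalGeneratingFunction

variable {N : ℕ}

/-- The generating function of the set of steps of a single edge that is present at each step
with probability `v`. -/
noncomputable def edgeGF (s : Finset (Fin N) → ℝ≥0) (v : ℝ) : ℝ :=
  ∑ A : Finset (Fin N), v ^ A.card * (1 - v) ^ (N - A.card) * s A

/-- The total rate in the generating function of the Poisson edges. -/
noncomputable def rateGF (s : Finset (Fin N) → ℝ≥0) : ℝ := ∑ n : Fin N, (1 - (s {n} : ℝ))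

lemma rateGF_nonneg {s : Finset (Fin N) → ℝ≥0} (hs : ∀ A, s A ≤ 1) : 0 ≤ rateGF s :=
  Finset.sum_nonneg fun n _ => sub_nonneg.2 (by exact_mod_cast hs {n})

lemma edgeGF_nonneg (s : Finset (Fin N) → ℝ≥0) {v : ℝ} (h0 : 0 ≤ v) (h1 : v ≤ 1) :
    0 ≤ edgeGF s v := by
  have := sub_nonneg.2 h1
  exact Finset.sum_nonneg fun A _ => by positivity

lemma sum_pow_card_mul_pow (v : ℝ) :
    ∑ A : Finset (Fin N), v ^ A.card * (1 - v) ^ (N - A.card) = 1 := by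
  have := Finset.sum_pow_mul_eq_add_pow v (1 - v) (Finset.univ : Finset (Fin N))
  simpa using this

lemma edgeGF_le_one {s : Finset (Fin N) → ℝ≥0} (hs : ∀ A, s A ≤ 1) {v : ℝ} (h0 : 0 ≤ v)
    (h1 : v ≤ 1) : edgeGF s v ≤ 1 := by
  have := sub_nonneg.2 h1
  rw [← sum_pow_card_mul_pow (N := N) v]
  refine Finset.sum_le_sum fun A _ => mul_le_of_le_one_right (by positivity) ?_
  exact_mod_cast hs A

lemma continuous_edgeGF (s : Finset (Fin N) → ℝ≥0) : Continuous (edgeGF s) := by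
  unfold edgeGF
  fun_prop

lemma edgeGF_eq_sum_range (s : Finset (Fin N) → ℝ≥0) (v : ℝ) :
    edgeGF s v = ∑ j ∈ Finset.range (N + 1), v ^ j * (1 - v) ^ (N - j) *
      ((∑ A : Finset (Fin N) with A.card = j, s A : ℝ≥0) : ℝ) := by
  rw [edgeGF, ← Finset.sum_fiberwise_of_maps_to (g := Finset.card) (t := Finset.range (N + 1))]
  · refine Finset.sum_congr rfl fun j _ => ?_
    push_cast
    rw [Finset.mul_sum]
    exact Finset.sum_congr rfl fun A hA => by rw [(Finset.mem_filter.1 hA).2]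
  · intro A _
    rw [Finset.mem_range, Nat.lt_succ_iff]
    simpa using A.card_le_univ

lemma edgeGF_sizeAverage (s : Finset (Fin N) → ℝ≥0) (v : ℝ) :
    edgeGF (fun A : Finset (Fin N) => sizeAverage s A.card) v = edgeGF s v := by
  rw [edgeGF_eq_sum_range, edgeGF_eq_sum_range]
  simp only [sum_sizeAverage]

lemma sum_singleton_eq (s : Finset (Fin N) → ℝ≥0) :
    ∑ n : Fin N, s {n} = ∑ A : Finset (Fin N) with A.card = 1, s A := by
  refine Finset.sum_bij (fun n _ => {n}) (by simp) (by simp) ?_ (by simp)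
  intro A hA
  obtain ⟨a, rfl⟩ := Finset.card_eq_one.1 (Finset.mem_filter.1 hA).2
  exact ⟨a, by simp, rfl⟩

lemma rateGF_sizeAverage (s : Finset (Fin N) → ℝ≥0) :
    rateGF (fun A : Finset (Fin N) => sizeAverage s A.card) = rateGF s := by
  have h := (sum_singleton_eq fun A : Finset (Fin N) => sizeAverage s A.card).trans
    ((sum_sizeAverage s 1).trans (sum_singleton_eq s).symm)
  simp only [rateGF, Finset.sum_sub_distrib]
  congr 1
  exact_mod_cast h

/-- The step collection of the first `N` steps of the construction, with the edges of index less
than `K` only. -/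
def truncCollection (N K : ℕ) (z : ℕ → ℕ → Bool) (u : ℕ → ℕ) : StepCollection N :=
  ((Finset.univ : Finset (Fin K)).val.map fun k : Fin K =>
      Finset.univ.filter fun n : Fin N => z n k = true).filter (· ≠ ∅) +
    ∑ n : Fin N, Multiset.replicate (u n) {n}

lemma StepCollection.weight_filter {s : Finset (Fin N) → ℝ≥0} (h0 : s ∅ = 1)
    (c : StepCollection N) : StepCollection.weight s (c.filter (· ≠ ∅)) = c.weight s := by
  induction c using Multiset.induction with
  | empty => simp
  | cons A c ih =>
    by_cases hA : A = ∅
    · subst hA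
      rw [Multiset.filter_cons_of_neg _ (by simp), ih]
      simp [StepCollection.weight, h0]
    · rw [Multiset.filter_cons_of_pos (p := (· ≠ ∅)) _ hA]
      simp only [StepCollection.weight, Multiset.map_cons, Multiset.prod_cons] at ih ⊢
      rw [ih]

lemma weight_truncCollection {s : Finset (Fin N) → ℝ≥0} (h0 : s ∅ = 1) (K : ℕ)
    (z : ℕ → ℕ → Bool) (u : ℕ → ℕ) :
    (truncCollection N K z u).weight s =
      (∏ k : Fin K, s (Finset.univ.filter fun n : Fin N => z n k = true)) *
        ∏ n : Fin N, s {n} ^ u n := by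
  have hadd : ∀ c d : StepCollection N,
      StepCollection.weight s (c + d) = c.weight s * d.weight s := fun c d => by
    simp [StepCollection.weight]
  have hsum : ∀ t : Finset (Fin N), StepCollection.weight s
      (∑ n ∈ t, Multiset.replicate (u n) ({n} : Finset (Fin N))) = ∏ n ∈ t, s {n} ^ u n := by
    intro t
    induction t using Finset.induction with
    | empty => simp [StepCollection.weight]
    | insert a t ha ih =>
      rw [Finset.sum_insert ha, Finset.prod_insert ha, hadd, ih]
      simp [StepCollection.weight]
  rw [truncCollection, hadd, hsum, StepCollection.weight_filter h0]
  rw [StepCollection.weight, Multiset.map_map]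
  rfl

lemma ENNReal.tsum_fin_pi_prod {n : ℕ} (f : Fin n → ℕ → ℝ≥0∞) :
    ∑' u : Fin n → ℕ, ∏ i, f i (u i) = ∏ i, ∑' j, f i j := by
  induction n with
  | zero => simp
  | succ n ih =>
    rw [← (Fin.consEquiv fun _ : Fin (n + 1) => ℕ).tsum_eq, ENNReal.tsum_prod',
      Fin.prod_univ_succ, ← ih, ← ENNReal.tsum_mul_right]
    refine tsum_congr fun a => ?_
    rw [← ENNReal.tsum_mul_left]
    refine tsum_congr fun u => ?_
    simp [Fin.consEquiv, Fin.prod_univ_succ]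

lemma tsum_pow_mul_poissonMeasure (r s : ℝ≥0) :
    ∑' j : ℕ, (s : ℝ≥0∞) ^ j * poissonMeasure r {j} =
      ENNReal.ofReal (Real.exp (-(r * (1 - s)))) := by
  have h : HasSum (fun j : ℕ => (s : ℝ) ^ j * (Real.exp (-r) * r ^ j / j.factorial))
      (Real.exp (-(r * (1 - s)))) := by
    have := (NormedSpace.expSeries_div_hasSum_exp ((r * s : ℝ≥0) : ℝ)).mul_left (Real.exp (-r))
    rw [← Real.exp_eq_exp_ℝ, ← Real.exp_add] at this
    rw [show Real.exp (-(r * (1 - s))) = Real.exp (-r + ((r * s : ℝ≥0) : ℝ)) by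
      rw [NNReal.coe_mul]
      ring_nf]
    refine this.congr_fun fun j => ?_
    rw [NNReal.coe_mul, mul_pow]
    ring
  rw [← h.tsum_eq, ENNReal.ofReal_tsum_of_nonneg (fun j => by positivity) h.summable]
  refine tsum_congr fun j => ?_
  rw [poissonMeasure_singleton, ENNReal.ofReal_mul (by positivity), ENNReal.ofReal_pow (by simp),
    ENNReal.ofReal_coe_nnreal]

lemma prod_bernoulliWeight (v : I) (A : Finset (Fin N)) :
    ∏ n : Fin N, bernoulliWeight v (decide (n ∈ A)) =
      ENNReal.ofReal ((v : ℝ) ^ A.card * (1 - (v : ℝ)) ^ (N - A.card)) := by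
  have h1 := v.2.1
  have h2 := sub_nonneg.2 v.2.2
  simp only [bernoulliWeight]
  rw [← ENNReal.ofReal_prod_of_nonneg]
  · congr 1
    simp only [decide_eq_true_eq]
    rw [Finset.prod_ite]
    simp only [Finset.prod_const]
    congr 2
    · simp
    · rw [Finset.filter_not, Finset.card_sdiff]
      simp
  · intro n _
    split_ifs <;> assumption

/-- Summation over all the outcomes of the first `N` steps, for fixed rate and frequencies. -/
lemma tsum_outcome_eq {s : Finset (Fin N) → ℝ≥0} (K : ℕ) (r : ℝ≥0) (v : Fin K → I) :
    ∑' y : (Fin K → Finset (Fin N)) × (Fin N → ℕ),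
      ((∏ k, (s (y.1 k) : ℝ≥0∞)) * ∏ n, (s {n} : ℝ≥0∞) ^ y.2 n) *
        ∏ n : Fin N, ((∏ k, bernoulliWeight (v k) (decide (n ∈ y.1 k))) *
          poissonMeasure r {y.2 n}) =
      ENNReal.ofReal (Real.exp (-(r * rateGF s)) * ∏ k, edgeGF s (v k)) := by
  rw [ENNReal.tsum_prod']
  have h : ∀ (a : Fin K → Finset (Fin N)) (u : Fin N → ℕ),
      ((∏ k, (s (a k) : ℝ≥0∞)) * ∏ n, (s {n} : ℝ≥0∞) ^ u n) *
        ∏ n : Fin N, ((∏ k, bernoulliWeight (v k) (decide (n ∈ a k))) *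
          poissonMeasure r {u n}) =
      (∏ k, ENNReal.ofReal ((v k : ℝ) ^ (a k).card * (1 - (v k : ℝ)) ^ (N - (a k).card) *
        s (a k))) * ∏ n, ((s {n} : ℝ≥0∞) ^ u n * poissonMeasure r {u n}) := by
    intro a u
    rw [Finset.prod_mul_distrib, Finset.prod_comm, Finset.prod_mul_distrib]
    simp_rw [prod_bernoulliWeight]
    have : ∀ k, ENNReal.ofReal ((v k : ℝ) ^ (a k).card * (1 - (v k : ℝ)) ^ (N - (a k).card) *
        s (a k)) = ENNReal.ofReal ((v k : ℝ) ^ (a k).card * (1 - (v k : ℝ)) ^ (N - (a k).card)) *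
          s (a k) := fun k => by
      rw [ENNReal.ofReal_mul' (by simp), ENNReal.ofReal_coe_nnreal]
    simp_rw [this]
    rw [Finset.prod_mul_distrib]
    ring
  simp only [h, ENNReal.tsum_mul_left, ENNReal.tsum_mul_right]
  rw [ENNReal.tsum_fin_pi_prod (fun n j => (s {n} : ℝ≥0∞) ^ j * poissonMeasure r {j})]
  simp only [tsum_pow_mul_poissonMeasure, tsum_fintype]
  have h2 := Finset.prod_univ_sum (fun _ : Fin K => (Finset.univ : Finset (Finset (Fin N))))
    (fun k A => ENNReal.ofReal ((v k : ℝ) ^ A.card * (1 - (v k : ℝ)) ^ (N - A.card) * s A))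
  rw [Fintype.piFinset_univ] at h2
  have hnn : ∀ (k : Fin K) (A : Finset (Fin N)),
      0 ≤ (v k : ℝ) ^ A.card * (1 - (v k : ℝ)) ^ (N - A.card) * s A := fun k A => by
    have h1 := (v k).2.1
    have h2 := sub_nonneg.2 (v k).2.2
    positivity
  rw [← h2, ← ENNReal.ofReal_prod_of_nonneg (fun n _ => (Real.exp_pos _).le),
    ENNReal.ofReal_mul (Real.exp_pos _).le, mul_comm]
  congr 1
  · congr 1
    rw [← Real.exp_sum, rateGF, Finset.mul_sum, Finset.sum_neg_distrib]
  · rw [ENNReal.ofReal_prod_of_nonneg fun k _ => edgeGF_nonneg s (v k).2.1 (v k).2.2]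
    refine Finset.prod_congr rfl fun k _ => ?_
    rw [edgeGF, ENNReal.ofReal_sum_of_nonneg fun A _ => hnn k A]

end ConditionalGeneratingFunction

section Draw

variable {Ω : Type*} [MeasurableSpace Ω] {μ : Measure Ω} {lam : Ω → ℝ≥0} {freq : Ω → ℕ → I}
  {Z : ℕ → ℕ → Ω → Bool} {U : ℕ → Ω → ℕ}

lemma measurable_bernoulliWeight (b : Bool) : Measurable fun v : I => bernoulliWeight v b := by
  unfold bernoulliWeight
  cases b <;> simp <;> fun_prop

lemma measurable_poissonMeasure_singleton (j : ℕ) :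
    Measurable fun r : ℝ≥0 => poissonMeasure r {j} := by
  simp only [poissonMeasure_singleton]
  fun_prop

lemma IsBernoulliPoissonDraw.measurable_truncCollection
    (h : IsBernoulliPoissonDraw μ lam freq Z U) (N K : ℕ) :
    Measurable fun ω => truncCollection N K (fun n k => Z n k ω) (fun n => U n ω) := by
  have h1 : Measurable fun ω => ((fun n k => Z n k ω, fun n => U n ω) :
      (Fin N → Fin K → Bool) × (Fin N → ℕ)) := by
    refine Measurable.prodMk ?_ ?_
    · exact measurable_pi_lambda _ fun n => measurable_pi_lambda _ fun k => h.measurable_Z n k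
    · exact measurable_pi_lambda _ fun n => h.measurable_U n
  have h2 : Measurable fun y : (Fin N → Fin K → Bool) × (Fin N → ℕ) =>
      (((Finset.univ : Finset (Fin K)).val.map fun k : Fin K =>
        Finset.univ.filter fun n : Fin N => y.1 n k = true).filter (· ≠ ∅) +
        ∑ n : Fin N, Multiset.replicate (y.2 n) {n} : StepCollection N) :=
    measurable_from_prod_countable_right fun _ => Measurable.of_discrete
  have h3 := h2.comp h1
  simp only [Function.comp_def] at h3
  unfold truncCollection
  exact h3

/-- The generating function of the truncated step collection. -/
theorem IsBernoulliPoissonDraw.lintegral_weight_truncCollection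
    (h : IsBernoulliPoissonDraw μ lam freq Z U) {N : ℕ} {s : Finset (Fin N) → ℝ≥0}
    (h0 : s ∅ = 1) (K : ℕ) :
    ∫⁻ ω, (truncCollection N K (fun n k => Z n k ω) (fun n => U n ω)).weight s ∂μ =
      ∫⁻ ω, ENNReal.ofReal (Real.exp (-(lam ω * rateGF s)) *
        ∏ k ∈ Finset.range K, edgeGF s (freq ω k)) ∂μ := by
  let Y : Ω → (Fin K → Finset (Fin N)) × (Fin N → ℕ) := fun ω =>
    (fun k => Finset.univ.filter fun n : Fin N => Z n k ω = true, fun n => U n ω)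
  let : MeasurableSpace (Finset (Fin N)) := ⊤
  have hY : Measurable Y := by
    refine Measurable.prodMk ?_ ?_
    · refine measurable_pi_lambda _ fun k => ?_
      have h1 : Measurable fun ω => (fun n => Z n k ω : Fin N → Bool) :=
        measurable_pi_lambda _ fun n => h.measurable_Z n k
      have h2 : Measurable fun x : Fin N → Bool => Finset.univ.filter fun n : Fin N => x n = true :=
        Measurable.of_discrete
      exact h2.comp h1
    · exact measurable_pi_lambda _ fun n => h.measurable_U n
  let w : (Fin K → Finset (Fin N)) × (Fin N → ℕ) → ℝ≥0∞ := fun y =>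
    (∏ k, (s (y.1 k) : ℝ≥0∞)) * ∏ n, (s {n} : ℝ≥0∞) ^ y.2 n
  have hw : ∀ ω, ((truncCollection N K (fun n k => Z n k ω) (fun n => U n ω)).weight s : ℝ≥0∞) =
      w (Y ω) := fun ω => by
    rw [weight_truncCollection h0]
    simp [w, Y]
  have hlaw : ∀ y, μ.map Y {y} = ∫⁻ ω, ∏ n : Fin N,
      ((∏ k : Fin K, bernoulliWeight (freq ω k) (decide (n ∈ y.1 k))) *
        poissonMeasure (lam ω) {y.2 n}) ∂μ := by
    intro y
    let z : ℕ → ℕ → Bool := fun n k =>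
      if hk : k < K then if hn : n < N then decide ((⟨n, hn⟩ : Fin N) ∈ y.1 ⟨k, hk⟩) else false
      else false
    let u : ℕ → ℕ := fun n => if hn : n < N then y.2 ⟨n, hn⟩ else 0
    have hj := h.joint_law Set.univ MeasurableSet.univ N K z u
    simp only [Set.mem_univ, true_and, Set.ofPred_true, Measure.restrict_univ] at hj
    rw [Measure.map_apply hY (MeasurableSet.singleton y)]
    have hset : Y ⁻¹' {y} = {ω | ∀ n < N, (∀ k < K, Z n k ω = z n k) ∧ U n ω = u n} := by
      ext ω
      simp only [Set.mem_preimage, Set.mem_singleton_iff, Set.mem_ofPred_eq, Y, Prod.ext_iff,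
        funext_iff, Finset.ext_iff, Finset.mem_filter, Finset.mem_univ, true_and]
      constructor
      · rintro ⟨h1, h2⟩ n hn
        refine ⟨fun k hk => ?_, ?_⟩
        · have := h1 ⟨k, hk⟩ ⟨n, hn⟩
          simp only [z, hk, hn, dif_pos]
          rw [Bool.eq_iff_iff, decide_eq_true_eq]
          exact this
        · simpa [u, hn] using h2 ⟨n, hn⟩
      · intro h1
        refine ⟨fun k n => ?_, fun n => ?_⟩
        · rw [(h1 n n.2).1 k k.2]
          simp [z]
        · rw [(h1 n n.2).2]
          simp [u]
    rw [hset, hj]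
    refine lintegral_congr fun ω => ?_
    rw [Finset.prod_range]
    refine Finset.prod_congr rfl fun n _ => ?_
    rw [Finset.prod_range]
    simp [z, u]
  have hmeas : ∀ y : (Fin K → Finset (Fin N)) × (Fin N → ℕ), Measurable fun ω => ∏ n : Fin N,
      ((∏ k : Fin K, bernoulliWeight (freq ω k) (decide (n ∈ y.1 k))) *
        poissonMeasure (lam ω) {y.2 n}) := by
    intro y
    refine Finset.measurable_fun_prod _ fun n _ => ?_
    refine Measurable.mul (Finset.measurable_fun_prod _ fun k _ => ?_) ?_
    · exact (measurable_bernoulliWeight _).comp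
        ((measurable_pi_apply _).comp h.measurable_freq)
    · exact (measurable_poissonMeasure_singleton _).comp h.measurable_lam
  simp only [hw]
  rw [← lintegral_map (f := w) Measurable.of_discrete hY, lintegral_countable']
  simp only [hlaw]
  simp only [← lintegral_const_mul _ (hmeas _)]
  rw [← lintegral_tsum fun y => ((hmeas y).const_mul _).aemeasurable]
  refine lintegral_congr fun ω => ?_
  rw [tsum_outcome_eq K (lam ω) fun k => freq ω k, Finset.prod_range]

end Draw

section Pathwise

variable {W : Type*} {g : GraphSeq W} {z : ℕ → ℕ → Bool} {u : ℕ → ℕ}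
  {lab : ℕ ⊕ (ℕ × ℕ) → Sym2 W}

lemma mem_step_iff (hinj : Set.InjOn lab (⋃ n, presentAt z u n))
    (hg : ∀ n, (g n : Set (Sym2 W)) = lab '' presentAt z u n) {i : ℕ ⊕ (ℕ × ℕ)}
    (hi : i ∈ ⋃ n, presentAt z u n) (n : ℕ) : lab i ∈ g n ↔ i ∈ presentAt z u n := by
  rw [← Finset.mem_coe, hg]
  exact hinj.mem_image_iff (Set.subset_iUnion _ n) hi

lemma inl_mem_presentAt {n k : ℕ} : Sum.inl k ∈ presentAt z u n ↔ z n k = true := by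
  simp [presentAt]

lemma inr_mem_presentAt {n m j : ℕ} :
    Sum.inr (m, j) ∈ presentAt z u n ↔ m = n ∧ j < u n := by
  simp [presentAt]

lemma exists_index_bound (hinj : Set.InjOn lab (⋃ n, presentAt z u n))
    (hg : ∀ n, (g n : Set (Sym2 W)) = lab '' presentAt z u n) (N : ℕ) :
    ∃ K₀, ∀ n < N, ∀ k, z n k = true → k < K₀ := by
  have hfin : ∀ n, {k | z n k = true}.Finite := fun n => by
    have h1 : (presentAt z u n).Finite := by
      refine Set.Finite.of_finite_image ?_ (hinj.mono (Set.subset_iUnion _ n))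
      rw [← hg]
      exact Finset.finite_toSet _
    refine Set.Finite.of_finite_image (f := Sum.inl) (h1.subset ?_) Sum.inl_injective.injOn
    rintro _ ⟨k, hk, rfl⟩
    exact inl_mem_presentAt.2 hk
  have h2 : (⋃ n ∈ Set.Iio N, {k | z n k = true}).Finite :=
    (Set.finite_Iio N).biUnion fun n _ => hfin n
  obtain ⟨K, hK⟩ := h2.bddAbove
  exact ⟨K + 1, fun n hn k hk => Nat.lt_succ_of_le (hK (Set.mem_biUnion hn hk))⟩

lemma stepCollection_eq_truncCollection (hinj : Set.InjOn lab (⋃ n, presentAt z u n))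
    (hg : ∀ n, (g n : Set (Sym2 W)) = lab '' presentAt z u n) {N K : ℕ}
    (hK : ∀ n < N, ∀ k, z n k = true → k < K) :
    stepCollection g N = truncCollection N K z u := by
  classical
  let emb : Fin K ⊕ (Σ _ : Fin N, ℕ) → ℕ ⊕ (ℕ × ℕ) :=
    Sum.map (fun k => (k : ℕ)) fun x => ((x.1 : ℕ), x.2)
  have hemb : Function.Injective emb := by
    refine Sum.map_injective.2 ⟨Fin.val_injective, ?_⟩
    rintro ⟨a, b⟩ ⟨c, d⟩ h
    simp only [Prod.mk.injEq, Fin.val_inj] at h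
    obtain ⟨rfl, rfl⟩ := h
    rfl
  let J : Finset (Fin K ⊕ (Σ _ : Fin N, ℕ)) :=
    ((Finset.univ : Finset (Fin K)).filter fun k : Fin K =>
      (Finset.univ.filter fun n : Fin N => z n k = true) ≠ ∅).disjSum
      (Finset.univ.sigma fun n : Fin N => Finset.range (u n))
  have hJN : ∀ i ∈ J, ∃ n : Fin N, emb i ∈ presentAt z u n := by
    rintro (k | ⟨n, j⟩) hi
    · simp only [J, Finset.inl_mem_disjSum, Finset.mem_filter, Finset.mem_univ, true_and,
        ne_eq, Finset.filter_eq_empty_iff, not_forall, not_not] at hi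
      obtain ⟨n, hn⟩ := hi
      exact ⟨n, inl_mem_presentAt.2 (by simpa using hn)⟩
    · simp only [J, Finset.inr_mem_disjSum, Finset.mem_sigma, Finset.mem_univ, true_and,
        Finset.mem_range] at hi
      exact ⟨n, inr_mem_presentAt.2 ⟨rfl, hi⟩⟩
  have hJ : ∀ i ∈ J, emb i ∈ ⋃ n, presentAt z u n := fun i hi =>
    let ⟨n, hn⟩ := hJN i hi
    Set.mem_iUnion.2 ⟨n, hn⟩
  have hseen : seenEdges g N = J.image (lab ∘ emb) := by
    ext e
    simp only [seenEdges, Finset.mem_biUnion, Finset.mem_univ, true_and, Finset.mem_image]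
    constructor
    · rintro ⟨n, hn⟩
      rw [← Finset.mem_coe, hg] at hn
      obtain ⟨(k | ⟨m, j⟩), hi, rfl⟩ := hn
      · have hz := inl_mem_presentAt.1 hi
        refine ⟨Sum.inl ⟨k, hK n n.2 k hz⟩, ?_, rfl⟩
        simp only [J, Finset.inl_mem_disjSum, Finset.mem_filter, Finset.mem_univ, true_and]
        exact Finset.nonempty_iff_ne_empty.1 ⟨n, by simpa using hz⟩
      · obtain ⟨rfl, hj⟩ := inr_mem_presentAt.1 hi
        exact ⟨Sum.inr ⟨n, j⟩, by simpa [J] using hj, rfl⟩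
    · rintro ⟨i, hi, rfl⟩
      obtain ⟨n, hn⟩ := hJN i hi
      exact ⟨n, (mem_step_iff hinj hg (hJ i hi) n).2 hn⟩
  have hinjJ : Set.InjOn (lab ∘ emb) J := fun i hi j hj hij =>
    hemb (hinj (hJ i hi) (hJ j hj) hij)
  rw [stepCollection, hseen, Finset.image_val_of_injOn hinjJ, Multiset.map_map]
  have hocc : ∀ i ∈ J.val, (occurrences g N ∘ lab ∘ emb) i = Sum.elim
      (fun k : Fin K => Finset.univ.filter fun n : Fin N => z n k = true) (fun x => {x.1}) i := by
    intro i hi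
    ext n
    simp only [occurrences, Function.comp_apply, Finset.mem_filter, Finset.mem_univ, true_and]
    rw [mem_step_iff hinj hg (hJ i hi)]
    rcases i with k | ⟨m, j⟩
    · simp only [emb, Sum.map_inl, Sum.elim_inl, Finset.mem_filter, Finset.mem_univ, true_and]
      exact inl_mem_presentAt
    · simp only [emb, Sum.map_inr, Sum.elim_inr, Finset.mem_singleton, inr_mem_presentAt]
      have hj : j < u m := by simpa [J] using hi
      constructor
      · rintro ⟨h1, -⟩
        exact (Fin.ext h1).symm
      · rintro rfl
        exact ⟨rfl, hj⟩
  rw [Multiset.map_congr rfl hocc]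
  simp only [J, Finset.val_disjSum, Multiset.disjSum, Multiset.map_add, Multiset.map_map,
    Function.comp_def, Sum.elim_inl, Sum.elim_inr, truncCollection]
  congr 1
  · rw [Multiset.filter_map]
    rfl
  · simp only [Finset.sigma, Multiset.sigma, Multiset.map_bind, Multiset.map_map,
      Function.comp_def, Multiset.map_const', Finset.card_val, Finset.card_range]
    rfl

end Pathwise

section FrequencyPoisson

variable {Ω W : Type*} [MeasurableSpace Ω] {μ : Measure Ω} {lam : Ω → ℝ≥0} {freq : Ω → ℕ → I}
  {G : Ω → GraphSeq W}

lemma IsFrequencyPoissonGraph.exists_draw (h : IsFrequencyPoissonGraph μ lam freq G) :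
    ∃ (Z : ℕ → ℕ → Ω → Bool) (U : ℕ → Ω → ℕ), IsBernoulliPoissonDraw μ lam freq Z U ∧
      ∀ᵐ ω ∂μ, ∀ N, ∀ᶠ K in Filter.atTop,
        truncCollection N K (fun n k => Z n k ω) (fun n => U n ω) = stepCollection (G ω) N := by
  obtain ⟨Z, U, lab, hdraw, hae⟩ := h
  refine ⟨Z, U, hdraw, ?_⟩
  filter_upwards [hae] with ω ⟨hinj, hg⟩ N
  obtain ⟨K₀, hK₀⟩ := exists_index_bound hinj hg N
  filter_upwards [Filter.eventually_ge_atTop K₀] with K hK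
  exact (stepCollection_eq_truncCollection hinj hg
    fun n hn k hk => (hK₀ n hn k hk).trans_le hK).symm

lemma IsFrequencyPoissonGraph.measurable (h : IsFrequencyPoissonGraph μ lam freq G) :
    Measurable lam ∧ Measurable freq := by
  obtain ⟨Z, U, hdraw, -⟩ := h.exists_draw
  exact ⟨hdraw.measurable_lam, hdraw.measurable_freq⟩

lemma IsFrequencyPoissonGraph.aemeasurable (h : IsFrequencyPoissonGraph μ lam freq G) (N : ℕ) :
    AEMeasurable (fun ω => stepCollection (G ω) N) μ := by
  obtain ⟨Z, U, hdraw, hae⟩ := h.exists_draw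
  refine aemeasurable_of_tendsto_metrizable_ae Filter.atTop
    (fun K => (hdraw.measurable_truncCollection N K).aemeasurable) ?_
  filter_upwards [hae] with ω hω
  exact tendsto_nhds_of_eventually_eq (hω N)

/-- The generating function of the step collection is the limit of those of the truncations. -/
theorem IsFrequencyPoissonGraph.tendsto_lintegral_weight [IsProbabilityMeasure μ]
    (h : IsFrequencyPoissonGraph μ lam freq G) {N : ℕ} {s : Finset (Fin N) → ℝ≥0}
    (hs : ∀ A, s A ≤ 1) (h0 : s ∅ = 1) :
    Filter.Tendsto (fun K => ∫⁻ ω, ENNReal.ofReal (Real.exp (-(lam ω * rateGF s)) *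
        ∏ k ∈ Finset.range K, edgeGF s (freq ω k)) ∂μ) Filter.atTop
      (nhds (∫⁻ ω, (stepCollection (G ω) N).weight s ∂μ)) := by
  obtain ⟨Z, U, hdraw, hae⟩ := h.exists_draw
  simp only [← hdraw.lintegral_weight_truncCollection h0]
  refine tendsto_lintegral_of_dominated_convergence (fun _ => 1) (fun K => ?_) (fun K => ?_)
    (by simp) ?_
  · exact (Measurable.of_discrete (f := fun c : StepCollection N => (c.weight s : ℝ≥0∞))).comp
      (hdraw.measurable_truncCollection N K)
  · exact Filter.Eventually.of_forall fun ω =>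
      ENNReal.coe_le_one_iff.2 (StepCollection.weight_le_one hs _)
  · filter_upwards [hae] with ω hω
    refine tendsto_nhds_of_eventually_eq ?_
    filter_upwards [hω N] with K hK
    rw [hK]

lemma StepCollection.weight_congr {N : ℕ} {s t : Finset (Fin N) → ℝ≥0}
    (h : ∀ A : Finset (Fin N), A.Nonempty → s A = t A) {c : StepCollection N}
    (hc : ∀ A ∈ c, A.Nonempty) : c.weight s = c.weight t := by
  rw [StepCollection.weight, StepCollection.weight]
  exact congrArg _ (Multiset.map_congr rfl fun A hA => h A (hc A hA))

theorem IsFrequencyPoissonGraph.hasEGPF [IsProbabilityMeasure μ]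
    (h : IsFrequencyPoissonGraph μ lam freq G) : HasEGPF μ G := by
  refine hasEGPF_of_lintegral_weight h.aemeasurable fun N s hs => ?_
  let t : Finset (Fin N) → ℝ≥0 := Function.update s ∅ 1
  have ht0 : t ∅ = 1 := by simp [t]
  have hne : ∀ A : Finset (Fin N), A.Nonempty → s A = t A := fun A hA => by
    simp [t, Function.update_of_ne hA.ne_empty]
  have ht : ∀ A, t A ≤ 1 := fun A => by
    by_cases hA : A = ∅
    · rw [hA, ht0]
    · rw [← hne A (Finset.nonempty_iff_ne_empty.2 hA)]
      exact hs A
  have havg : ∀ A : Finset (Fin N), A.Nonempty →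
      sizeAverage s A.card = sizeAverage t A.card := fun A hA => by
    unfold sizeAverage
    congr 1
    refine Finset.sum_congr rfl fun B hB => hne B ?_
    rw [← Finset.card_pos, (Finset.mem_filter.1 hB).2, Finset.card_pos]
    exact hA
  have ht0' : sizeAverage t (∅ : Finset (Fin N)).card = 1 := by
    simp [sizeAverage, Finset.filter_eq', ht0]
  have h1 := h.tendsto_lintegral_weight ht ht0
  have h2 := h.tendsto_lintegral_weight (s := fun A : Finset (Fin N) => sizeAverage t A.card)
    (fun A => sizeAverage_le_one ht _) ht0'
  simp only [rateGF_sizeAverage, edgeGF_sizeAverage] at h2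
  rw [lintegral_congr fun ω => by
      rw [StepCollection.weight_congr hne fun A hA => nonempty_of_mem_stepCollection hA],
    tendsto_nhds_unique h1 h2]
  exact lintegral_congr fun ω => by
    rw [StepCollection.weight_congr havg fun A hA => nonempty_of_mem_stepCollection hA]

end FrequencyPoisson

section Existence

lemma measurable_poissonMeasure : Measurable poissonMeasure := by
  refine Measure.measurable_of_measurable_coe _ fun s hs => ?_
  simp only [poissonMeasure, Measure.sum_apply _ hs, Measure.smul_apply, smul_eq_mul]
  refine Measurable.tsum fun n => Measurable.mul_const ?_ _
  fun_prop

/-- A jointly measurable simulation of Poisson variables by uniform ones. -/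
lemma exists_poisson_simulation :
    ∃ f : ℝ≥0 → I → ℕ, Measurable (Function.uncurry f) ∧
      ∀ r, (volume : Measure I).map (f r) = poissonMeasure r := by
  let κ : Kernel ℝ≥0 ℕ := ⟨poissonMeasure, measurable_poissonMeasure⟩
  have : IsMarkovKernel κ := ⟨fun r => inferInstanceAs (IsProbabilityMeasure (poissonMeasure r))⟩
  exact κ.exists_measurable_map_eq_unitInterval

/-- Independent uniform seeds: `(n, some k)` for the edge with index `k` at step `n`, `(n, none)`
for the number of further edges at step `n`. -/
noncomputable def seedMeasure : Measure (ℕ × Option ℕ → I) :=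
  Measure.infinitePi fun _ => (volume : Measure I)

instance : IsProbabilityMeasure seedMeasure := by
  unfold seedMeasure
  infer_instance

lemma volume_decide_lt_eq (v : I) (b : Bool) :
    (volume : Measure I) {x | decide (x < v) = b} = bernoulliWeight v b := by
  cases b
  · have : {x : I | decide (x < v) = false} = Set.Ici v := by ext; simp
    rw [this, unitInterval.volume_Ici]
    simp [bernoulliWeight]
  · have : {x : I | decide (x < v) = true} = Set.Iio v := by ext; simp
    rw [this, unitInterval.volume_Iio]
    simp [bernoulliWeight]

variable {π : Measure (ℝ≥0 × (ℕ → I))} {f : ℝ≥0 → I → ℕ}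

lemma isBernoulliPoissonDraw_seed [IsProbabilityMeasure π] (hf : Measurable (Function.uncurry f))
    (hlaw : ∀ r, (volume : Measure I).map (f r) = poissonMeasure r) :
    IsBernoulliPoissonDraw (π.prod seedMeasure) (fun ω => ω.1.1) (fun ω => ω.1.2)
      (fun n k ω => decide (ω.2 (n, some k) < ω.1.2 k)) (fun n ω => f ω.1.1 (ω.2 (n, none))) := by
  have hZ : ∀ n k, Measurable fun ω : (ℝ≥0 × (ℕ → I)) × (ℕ × Option ℕ → I) =>
      decide (ω.2 (n, some k) < ω.1.2 k) := fun n k => by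
    refine measurable_to_bool ?_
    have : (fun ω : (ℝ≥0 × (ℕ → I)) × (ℕ × Option ℕ → I) =>
        decide (ω.2 (n, some k) < ω.1.2 k)) ⁻¹' {true} = {ω | ω.2 (n, some k) < ω.1.2 k} := by
      ext
      simp
    rw [this]
    exact measurableSet_lt (by fun_prop) (by fun_prop)
  have hU : ∀ n, Measurable fun ω : (ℝ≥0 × (ℕ → I)) × (ℕ × Option ℕ → I) =>
      f ω.1.1 (ω.2 (n, none)) := fun n =>
    hf.comp (Measurable.prodMk (by fun_prop) (by fun_prop))
  refine ⟨by fun_prop, by fun_prop, hZ, hU, fun B hB N K z u => ?_⟩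
  let h : ℝ≥0 × (ℕ → I) → ℝ≥0∞ := fun x => ∏ n ∈ Finset.range N,
    ((∏ k ∈ Finset.range K, bernoulliWeight (x.2 k) (z n k)) * poissonMeasure x.1 {u n})
  have hh : Measurable h := by
    refine Finset.measurable_fun_prod _ fun n _ => ?_
    refine Measurable.mul (Finset.measurable_fun_prod _ fun k _ => ?_) ?_
    · exact (measurable_bernoulliWeight _).comp (by fun_prop)
    · exact (measurable_poissonMeasure_singleton _).comp measurable_fst
  have hR := (measurePreserving_fst (μ := π) (ν := seedMeasure)).setLIntegral_comp_preimage hB hh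
  refine Eq.trans ?_ hR.symm
  have hset : MeasurableSet {ω : (ℝ≥0 × (ℕ → I)) × (ℕ × Option ℕ → I) |
      (ω.1.1, ω.1.2) ∈ B ∧ ∀ n < N, (∀ k < K, decide (ω.2 (n, some k) < ω.1.2 k) = z n k) ∧
        f ω.1.1 (ω.2 (n, none)) = u n} := by
    simp only [Set.ofPred_and, Set.ofPred_forall]
    refine MeasurableSet.inter (measurable_fst hB) ?_
    refine MeasurableSet.iInter fun n => MeasurableSet.iInter fun _ => ?_
    refine MeasurableSet.inter ?_ (hU n (MeasurableSet.singleton (u n)))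
    exact MeasurableSet.iInter fun k => MeasurableSet.iInter fun _ =>
      hZ n k (MeasurableSet.singleton (z n k))
  rw [Measure.prod_apply hset, ← lintegral_indicator hB]
  refine lintegral_congr fun x => ?_
  by_cases hx : x ∈ B
  · rw [Set.indicator_of_mem hx]
    let t : ℕ × Option ℕ → Set I := fun i => i.2.elim {y | f x.1 y = u i.1}
      fun k => {y | decide (y < x.2 k) = z i.1 k}
    have hpi : (Prod.mk x ⁻¹' {ω : (ℝ≥0 × (ℕ → I)) × (ℕ × Option ℕ → I) |
        (ω.1.1, ω.1.2) ∈ B ∧ ∀ n < N, (∀ k < K, decide (ω.2 (n, some k) < ω.1.2 k) = z n k) ∧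
          f ω.1.1 (ω.2 (n, none)) = u n}) =
        Set.pi (Finset.range N ×ˢ Finset.insertNone (Finset.range K) : Finset (ℕ × Option ℕ)) t := by
      ext y
      simp only [Set.mem_preimage, Set.mem_ofPred_eq, Set.mem_pi, Finset.mem_coe,
        Finset.mem_product, Finset.mem_range, Finset.mem_insertNone, Prod.forall]
      constructor
      · rintro ⟨-, h1⟩ n (_ | k) ⟨hn, hk⟩
        · exact (h1 n hn).2
        · exact (h1 n hn).1 k (hk k rfl)
      · intro h1
        refine ⟨hx, fun n hn => ⟨fun k hk => ?_, ?_⟩⟩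
        · exact h1 n (some k) ⟨hn, fun a ha => by
            obtain rfl : k = a := by simpa using ha
            exact hk⟩
        · exact h1 n none ⟨hn, fun a ha => by simp at ha⟩
    have hfx : Measurable (f x.1) := hf.of_uncurry_left
    have ht : ∀ i, MeasurableSet (t i) := by
      rintro ⟨n, _ | k⟩
      · exact hfx (MeasurableSet.singleton (u n))
      · have : Measurable fun y : I => decide (y < x.2 k) := by
          refine measurable_to_bool ?_
          have : (fun y : I => decide (y < x.2 k)) ⁻¹' {true} = Set.Iio (x.2 k) := by
            ext
            simp
          rw [this]
          exact measurableSet_Iio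
        exact this (MeasurableSet.singleton (z n k))
    rw [hpi, seedMeasure, Measure.infinitePi_pi _ fun i _ => ht i, Finset.prod_product]
    refine Finset.prod_congr rfl fun n _ => ?_
    rw [Finset.prod_insertNone, mul_comm]
    congr 1
    · exact Finset.prod_congr rfl fun k _ => volume_decide_lt_eq _ _
    · rw [← hlaw, Measure.map_apply hfx (MeasurableSet.singleton _)]
      rfl
  · rw [Set.indicator_of_notMem hx]
    have : (Prod.mk x ⁻¹' {ω : (ℝ≥0 × (ℕ → I)) × (ℕ × Option ℕ → I) |
        (ω.1.1, ω.1.2) ∈ B ∧ ∀ n < N, (∀ k < K, decide (ω.2 (n, some k) < ω.1.2 k) = z n k) ∧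
          f ω.1.1 (ω.2 (n, none)) = u n}) = ∅ := by
      ext y
      simp only [Set.mem_preimage, Set.mem_ofPred_eq, Set.mem_empty_iff_false, iff_false]
      exact fun h => hx h.1
    rw [this, measure_empty]

/-- With summable frequencies, almost surely finitely many indices are present at each step. -/
lemma ae_finite_seed (hπ : ∀ᵐ x ∂π, Summable fun k => (x.2 k : ℝ)) :
    ∀ᵐ ω ∂(π.prod seedMeasure), ∀ n, {k | ω.2 (n, some k) < ω.1.2 k}.Finite := by
  rw [ae_all_iff]
  intro n
  let E : ℕ → Set ((ℝ≥0 × (ℕ → I)) × (ℕ × Option ℕ → I)) := fun k =>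
    {ω | ω.2 (n, some k) < ω.1.2 k}
  have hE : ∀ k, MeasurableSet (E k) := fun k => measurableSet_lt (by fun_prop) (by fun_prop)
  have hnull : (π.prod seedMeasure) (Filter.limsup E Filter.atTop) = 0 := by
    rw [Measure.measure_prod_null (MeasurableSet.measurableSet_limsup hE)]
    filter_upwards [hπ] with x hx
    have : Prod.mk x ⁻¹' Filter.limsup E Filter.atTop =
        Filter.limsup (fun k => {y : ℕ × Option ℕ → I | y (n, some k) < x.2 k}) Filter.atTop := by
      ext y
      simp only [Set.mem_preimage, Filter.mem_limsup_iff_frequently_mem, E, Set.mem_ofPred_eq]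
    rw [this]
    refine measure_limsup_atTop_eq_zero ?_
    have hv : ∀ k, seedMeasure {y | y (n, some k) < x.2 k} = ENNReal.ofReal (x.2 k) := fun k => by
      have := (measurePreserving_eval_infinitePi (fun _ : ℕ × Option ℕ => (volume : Measure I))
        (n, some k)).measure_preimage (measurableSet_Iio (a := x.2 k)).nullMeasurableSet
      rw [unitInterval.volume_Iio] at this
      exact this
    simp only [hv]
    rw [← ENNReal.ofReal_tsum_of_nonneg (fun k => (x.2 k).2.1) hx]
    exact ENNReal.ofReal_ne_top
  filter_upwards [measure_eq_zero_iff_ae_notMem.1 hnull] with ω hω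
  rw [Filter.mem_limsup_iff_frequently_mem, Nat.frequently_atTop_iff_infinite] at hω
  exact Set.not_infinite.1 hω

/-- The injective labelling of all indices by loops. -/
def loopLabel (i : ℕ ⊕ (ℕ × ℕ)) : Sym2 ℕ := s(Encodable.encode i, Encodable.encode i)

lemma loopLabel_injective : Function.Injective loopLabel := fun i j h => by
  simpa [loopLabel] using h

open Classical in
/-- The graph sequence with given present indices, if these are finite in number. -/
noncomputable def loopGraph (z : ℕ → ℕ → Bool) (u : ℕ → ℕ) : GraphSeq ℕ := fun n =>
  if h : (presentAt z u n).Finite then h.toFinset.image loopLabel else ∅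

theorem exists_isFrequencyPoissonGraph (π : Measure (ℝ≥0 × (ℕ → I))) [IsProbabilityMeasure π]
    (hπ : ∀ᵐ x ∂π, Summable fun k => (x.2 k : ℝ)) :
    ∃ (Ω : Type) (_ : MeasurableSpace Ω) (μ : Measure Ω) (lam : Ω → ℝ≥0) (freq : Ω → ℕ → I)
      (G : Ω → GraphSeq ℕ),
      IsProbabilityMeasure μ ∧ μ.map (fun ω => (lam ω, freq ω)) = π ∧
      IsFrequencyPoissonGraph μ lam freq G := by
  obtain ⟨f, hf, hlaw⟩ := exists_poisson_simulation
  refine ⟨(ℝ≥0 × (ℕ → I)) × (ℕ × Option ℕ → I), inferInstance, π.prod seedMeasure,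
    fun ω => ω.1.1, fun ω => ω.1.2,
    fun ω => loopGraph (fun n k => decide (ω.2 (n, some k) < ω.1.2 k))
      (fun n => f ω.1.1 (ω.2 (n, none))), inferInstance, ?_, ?_⟩
  · exact (measurePreserving_fst (μ := π) (ν := seedMeasure)).map_eq
  · refine ⟨_, _, fun _ => loopLabel, isBernoulliPoissonDraw_seed hf hlaw, ?_⟩
    filter_upwards [ae_finite_seed hπ] with ω hω
    refine ⟨loopLabel_injective.injOn, fun n => ?_⟩
    have hfin : (presentAt (fun n k => decide (ω.2 (n, some k) < ω.1.2 k))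
        (fun n => f ω.1.1 (ω.2 (n, none))) n).Finite := by
      refine Set.Finite.union (Set.Finite.image _ ?_) (Set.Finite.image _ ?_)
      · simpa using hω n
      · refine ((Set.finite_singleton n).prod
          (Set.finite_Iio (f ω.1.1 (ω.2 (n, none))))).subset ?_
        rintro ⟨a, b⟩ ⟨h1, h2⟩
        exact ⟨h1, h2⟩
    simp [loopGraph, hfin]

end Existence

section Restriction

variable {M N : ℕ}

/-- The part of a set of steps that lies in the first `M` steps. -/
def restrictSteps (h : M ≤ N) (A : Finset (Fin N)) : Finset (Fin M) :=
  Finset.univ.filter fun n => Fin.castLE h n ∈ A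

/-- The restriction of a step collection to the first `M` steps. -/
def StepCollection.restrict (h : M ≤ N) (c : StepCollection N) : StepCollection M :=
  (c.map (restrictSteps h)).filter (· ≠ ∅)

lemma stepCollection_restrict {W : Type*} (g : GraphSeq W) (h : M ≤ N) :
    (stepCollection g N).restrict h = stepCollection g M := by
  classical
  have hocc : restrictSteps h ∘ occurrences g N = occurrences g M := by
    ext e n
    simp [restrictSteps, occurrences]
  have hseen : (seenEdges g N).filter (fun e => occurrences g M e ≠ ∅) = seenEdges g M := by
    ext e
    simp only [seenEdges, Finset.mem_filter, Finset.mem_biUnion, Finset.mem_univ, true_and,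
      occurrences, ne_eq, Finset.filter_eq_empty_iff, not_forall, not_not, forall_const]
    constructor
    · rintro ⟨-, n, hn⟩
      exact ⟨n, hn⟩
    · rintro ⟨n, hn⟩
      exact ⟨⟨Fin.castLE h n, hn⟩, n, hn⟩
  rw [StepCollection.restrict, stepCollection, Multiset.map_map, hocc, Multiset.filter_map,
    stepCollection, ← hseen]
  rfl

lemma StepCollection.weight_restrict {s : Finset (Fin M) → ℝ≥0} (h0 : s ∅ = 1) (h : M ≤ N)
    (c : StepCollection N) : (c.restrict h).weight s = c.weight (s ∘ restrictSteps h) := by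
  rw [StepCollection.restrict, StepCollection.weight_filter h0]
  simp [StepCollection.weight]

lemma card_restrictSteps_fiber (h : M ≤ N) (A : Finset (Fin M)) {j : ℕ} (hj : A.card ≤ j) :
    (Finset.univ.filter fun B : Finset (Fin N) => B.card = j ∧ restrictSteps h B = A).card =
      (N - M).choose (j - A.card) := by
  classical
  let T : Finset (Fin N) := Finset.univ.filter fun n => M ≤ (n : ℕ)
  have hT : T.card = N - M := by
    have h1 : T = (Finset.univ.map (Fin.castLEEmb h))ᶜ := by
      ext n
      simp only [T, Finset.mem_filter, Finset.mem_univ, true_and, Finset.mem_compl,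
        Finset.mem_map, Fin.castLEEmb_apply, not_exists]
      constructor
      · rintro hn m rfl
        exact absurd m.2 (not_lt.2 hn)
      · intro hn
        by_contra! hlt
        exact hn ⟨n, hlt⟩ rfl
    rw [h1, Finset.card_compl, Finset.card_map]
    simp
  rw [← hT, ← Finset.card_powersetCard]
  have hdisj : ∀ C ⊆ T, Disjoint (A.map (Fin.castLEEmb h)) C := by
    intro C hC
    rw [Finset.disjoint_left]
    intro n hn hn'
    obtain ⟨m, -, rfl⟩ := Finset.mem_map.1 hn
    exact absurd m.2 (not_lt.2 (Finset.mem_filter.1 (hC hn')).2)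
  refine Finset.card_bij' (fun B _ => B.filter fun n : Fin N => M ≤ (n : ℕ))
    (fun C _ => A.map (Fin.castLEEmb h) ∪ C) ?_ ?_ ?_ ?_
  · intro B hB
    obtain ⟨hBj, hBA⟩ := (Finset.mem_filter.1 hB).2
    rw [Finset.mem_powersetCard]
    refine ⟨Finset.filter_subset_filter _ (Finset.subset_univ _), ?_⟩
    have h1 := Finset.card_filter_add_card_filter_not (s := B) (fun n : Fin N => M ≤ (n : ℕ))
    have h2 : (B.filter fun n : Fin N => ¬ M ≤ (n : ℕ)).card = A.card := by
      rw [← hBA, ← Finset.card_map (Fin.castLEEmb h)]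
      congr 1
      ext n
      simp only [Finset.mem_filter, restrictSteps, Finset.mem_map, Finset.mem_univ, true_and,
        Fin.castLEEmb_apply, not_le]
      constructor
      · rintro ⟨h1, h2⟩
        exact ⟨⟨n, h2⟩, h1, rfl⟩
      · rintro ⟨m, h1, rfl⟩
        exact ⟨h1, m.2⟩
    omega
  · intro C hC
    obtain ⟨hCT, hCj⟩ := Finset.mem_powersetCard.1 hC
    simp only [Finset.mem_filter, Finset.mem_univ, true_and]
    refine ⟨?_, ?_⟩
    · rw [Finset.card_union_of_disjoint (hdisj C hCT), Finset.card_map, hCj]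
      omega
    · ext m
      simp only [restrictSteps, Finset.mem_filter, Finset.mem_univ, true_and, Finset.mem_union,
        Finset.mem_map, Fin.castLEEmb_apply]
      constructor
      · rintro (⟨a, ha, hma⟩ | hm)
        · rwa [← Fin.castLE_injective h hma]
        · exact absurd m.2 (not_lt.2 (Finset.mem_filter.1 (hCT hm)).2)
      · exact fun hm => Or.inl ⟨m, hm, rfl⟩
  · intro B hB
    obtain ⟨hBj, hBA⟩ := (Finset.mem_filter.1 hB).2
    ext n
    simp only [← hBA, Finset.mem_union, Finset.mem_filter, restrictSteps, Finset.mem_map,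
      Finset.mem_univ, true_and, Fin.castLEEmb_apply]
    constructor
    · rintro (⟨m, hm, rfl⟩ | ⟨hn, -⟩)
      · exact hm
      · exact hn
    · intro hn
      rcases lt_or_ge (n : ℕ) M with hlt | hge
      · exact Or.inl ⟨⟨n, hlt⟩, hn, rfl⟩
      · exact Or.inr ⟨hn, hge⟩
  · intro C hC
    obtain ⟨hCT, hCj⟩ := Finset.mem_powersetCard.1 hC
    ext n
    simp only [Finset.mem_filter, Finset.mem_union, Finset.mem_map, Fin.castLEEmb_apply]
    constructor
    · rintro ⟨⟨m, -, rfl⟩ | hn, hM⟩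
      · exact absurd m.2 (not_lt.2 hM)
      · exact hn
    · exact fun hn => ⟨Or.inr hn, (Finset.mem_filter.1 (hCT hn)).2⟩

lemma Nat.choose_mul_descFactorial_sub {N : ℕ} (b j : ℕ) (hb : b ≤ N) (hj : j ≤ N) :
    N.choose j * (N - j).descFactorial b = N.descFactorial b * (N - b).choose j := by
  induction b generalizing N with
  | zero => simp
  | succ b ih =>
    obtain ⟨n, rfl⟩ : ∃ n, N = n + 1 := ⟨N - 1, by omega⟩
    rw [Nat.succ_descFactorial_succ, Nat.add_sub_add_right]
    rcases Nat.lt_or_ge n j with h | h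
    · obtain rfl : j = n + 1 := by omega
      simp [Nat.choose_eq_zero_of_lt (show n - b < n + 1 by omega)]
    · rw [Nat.succ_sub h, Nat.succ_eq_add_one, Nat.succ_descFactorial_succ, ← mul_assoc,
        ← Nat.succ_eq_add_one (n - j), ← Nat.succ_sub h, Nat.succ_eq_add_one,
        ← Nat.choose_mul_succ_eq, mul_comm (n.choose j), mul_assoc, ih (by omega) h, mul_assoc]

lemma Nat.choose_mul_descFactorial_mul_descFactorial {N j : ℕ} (a b : ℕ) (hab : a + b ≤ N)
    (haj : a ≤ j) (hj : j ≤ N) :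
    N.choose j * (j.descFactorial a * (N - j).descFactorial b) =
      N.descFactorial (a + b) * (N - (a + b)).choose (j - a) := by
  induction a generalizing N j with
  | zero => simpa using Nat.choose_mul_descFactorial_sub b j (by omega) hj
  | succ a ih =>
    obtain ⟨n, rfl⟩ : ∃ n, N = n + 1 := ⟨N - 1, by omega⟩
    obtain ⟨i, rfl⟩ : ∃ i, j = i + 1 := ⟨j - 1, by omega⟩
    have := ih (N := n) (j := i) (by omega) (by omega) (by omega)
    rw [Nat.succ_descFactorial_succ, Nat.add_sub_add_right, Nat.add_sub_add_right,
      show a + 1 + b = a + b + 1 by ring, Nat.succ_descFactorial_succ, Nat.add_sub_add_right,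
      mul_assoc (n + 1), ← this]
    have h2 := Nat.add_one_mul_choose_eq n i
    calc _ = ((n + 1).choose (i + 1) * (i + 1)) * (i.descFactorial a * (n - i).descFactorial b) := by
          ring
      _ = _ := by rw [← h2]; ring

/-- The hypergeometric weight: the probability that a uniform set of `j` out of `N` steps meets
the first `M` steps in a given set of size `a`. -/
noncomputable def hypergeometricWeight (M N j a : ℕ) : ℝ :=
  (j.descFactorial a * (N - j).descFactorial (M - a) : ℕ) / (N.descFactorial M : ℝ)

lemma sizeAverage_restrictSteps (h : M ≤ N) (s : Finset (Fin M) → ℝ≥0) {j : ℕ} (hj : j ≤ N) :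
    (sizeAverage (s ∘ restrictSteps h) j : ℝ) =
      ∑ A : Finset (Fin M), hypergeometricWeight M N j A.card * s A := by
  have hc : (N.choose j : ℝ) ≠ 0 := by exact_mod_cast (Nat.choose_pos hj).ne'
  have hd : (N.descFactorial M : ℝ) ≠ 0 := by exact_mod_cast (Nat.descFactorial_pos.2 h).ne'
  rw [sizeAverage]
  push_cast
  rw [← Finset.sum_fiberwise (g := restrictSteps h), Finset.sum_div]
  refine Finset.sum_congr rfl fun A _ => ?_
  rw [Finset.sum_congr rfl (g := fun _ => (s A : ℝ)) fun B hB => by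
    simp [(Finset.mem_filter.1 hB).2], Finset.sum_const, nsmul_eq_mul, Finset.filter_filter,
    hypergeometricWeight]
  have hAM : A.card ≤ M := by simpa using A.card_le_univ
  rcases le_or_gt A.card j with hA | hA
  · rw [card_restrictSteps_fiber h A hA]
    have := Nat.choose_mul_descFactorial_mul_descFactorial (N := N) (j := j) A.card (M - A.card)
      (by omega) hA hj
    rw [Nat.add_sub_cancel' hAM] at this
    have h2 : (N.choose j : ℝ) * (j.descFactorial A.card * (N - j).descFactorial (M - A.card) : ℕ) =
        N.descFactorial M * ((N - M).choose (j - A.card) : ℕ) := by exact_mod_cast this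
    field_simp
    linear_combination (-(s A : ℝ)) * h2
  · rw [Nat.descFactorial_of_lt hA, Finset.filter_false_of_mem]
    · simp
    · rintro B - ⟨hB, rfl⟩
      refine absurd hA (not_lt.2 ?_)
      rw [← hB, ← Finset.card_map (Fin.castLEEmb h)]
      refine Finset.card_le_card fun n hn => ?_
      obtain ⟨m, hm, rfl⟩ := Finset.mem_map.1 hn
      exact (Finset.mem_filter.1 hm).2

end Restriction

section Estimate

lemma descFactorial_div_pow_bounds {n N : ℕ} (hN : 0 < N) (hn : n ≤ N) (a : ℕ) :
    (n.descFactorial a : ℝ) / N ^ a ≤ ((n : ℝ) / N) ^ a ∧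
      ((n : ℝ) / N) ^ a - (n.descFactorial a : ℝ) / N ^ a ≤ (n : ℝ) / N * (a ^ 2 / N) := by
  have hN' : (0 : ℝ) < N := by exact_mod_cast hN
  have hy1 : (n : ℝ) / N ≤ 1 := (div_le_one hN').2 (by exact_mod_cast hn)
  have hy0 : 0 ≤ (n : ℝ) / N := by positivity
  have hle : ∀ a : ℕ, (n.descFactorial a : ℝ) / N ^ a ≤ ((n : ℝ) / N) ^ a := fun a => by
    rw [div_pow]
    gcongr
    exact_mod_cast Nat.descFactorial_le_pow n a
  refine ⟨hle a, ?_⟩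
  induction a with
  | zero => simp
  | succ a ih =>
    have hP : (0 : ℝ) ≤ (n.descFactorial a : ℝ) / N ^ a := by positivity
    have hstep : ((n : ℝ) - a) / N * ((n.descFactorial a : ℝ) / N ^ a) ≤
        (n.descFactorial (a + 1) : ℝ) / N ^ (a + 1) := by
      rw [Nat.descFactorial_succ, pow_succ', div_mul_div_comm]
      push_cast
      gcongr
      have : (n : ℝ) ≤ ((n - a : ℕ) : ℝ) + a := by
        have h2 : n ≤ n - a + a := by omega
        exact_mod_cast h2
      linarith
    have hPa : (a : ℝ) / N * ((n.descFactorial a : ℝ) / N ^ a) ≤ a / N * ((n : ℝ) / N) := by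
      rcases Nat.eq_zero_or_pos a with rfl | ha
      · simp
      · exact mul_le_mul_of_nonneg_left ((hle a).trans (pow_le_of_le_one hy0 hy1 ha.ne'))
          (by positivity)
    have h3 : (n : ℝ) / N * ((n : ℝ) / N * (a ^ 2 / N)) ≤ (n : ℝ) / N * (a ^ 2 / N) := by
      refine mul_le_of_le_one_left (by positivity) hy1
    have h4 := mul_le_mul_of_nonneg_left ih hy0
    rw [pow_succ']
    push_cast
    have h5 : (n : ℝ) / N * (((a : ℝ) + 1) ^ 2 / N) = (n : ℝ) / N * (a ^ 2 / N) +
        a / N * ((n : ℝ) / N) + (n : ℝ) / N * ((a + 1) / N) := by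
      ring
    have h6 : 0 ≤ (n : ℝ) / N * ((a + 1) / N) := by positivity
    rw [sub_div, sub_mul] at hstep
    rw [h5]
    linarith [mul_sub ((n : ℝ) / N) (((n : ℝ) / N) ^ a) ((n.descFactorial a : ℝ) / N ^ a)]

/-- The error in replacing hypergeometric weights by binomial ones. -/
noncomputable def samplingError (M N : ℕ) : ℝ :=
  ((N : ℝ) ^ M / N.descFactorial M - 1) + 2 * M ^ 2 / N

lemma one_le_pow_div_descFactorial {M N : ℕ} (h : M ≤ N) :
    1 ≤ (N : ℝ) ^ M / N.descFactorial M := by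
  rw [one_le_div (by exact_mod_cast Nat.descFactorial_pos.2 h)]
  exact_mod_cast Nat.descFactorial_le_pow N M

lemma samplingError_nonneg {M N : ℕ} (h : M ≤ N) : 0 ≤ samplingError M N :=
  add_nonneg (sub_nonneg.2 (one_le_pow_div_descFactorial h)) (by positivity)

lemma tendsto_samplingError (M : ℕ) :
    Filter.Tendsto (samplingError M) Filter.atTop (nhds 0) := by
  have h1 : Filter.Tendsto (fun N : ℕ => (N.descFactorial M : ℝ) / (N : ℝ) ^ M) Filter.atTop
      (nhds 1) := by
    have h2 : Filter.Tendsto (fun N : ℕ => 1 - (M : ℝ) ^ 2 / N) Filter.atTop (nhds 1) := by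
      simpa using (tendsto_const_div_atTop_nhds_zero_nat ((M : ℝ) ^ 2)).const_sub 1
    refine tendsto_of_tendsto_of_tendsto_of_le_of_le' h2 tendsto_const_nhds ?_ ?_
    all_goals
      filter_upwards [Filter.eventually_gt_atTop 0] with N hN
      have := descFactorial_div_pow_bounds hN le_rfl M
      rw [div_self (by positivity), one_pow] at this
      linarith [this.1, this.2]
  have h3 := h1.inv₀ one_ne_zero
  have h4 := (h3.sub_const 1).add (tendsto_const_div_atTop_nhds_zero_nat (2 * (M : ℝ) ^ 2))
  simp only [inv_one, sub_self, add_zero, inv_div] at h4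
  exact h4

lemma abs_hypergeometricWeight_sub_le {M N j a : ℕ} (hN : 0 < N) (hM : M ≤ N) (hj : j ≤ N)
    (ha : a ≠ 0) (haM : a ≤ M) :
    |hypergeometricWeight M N j a - ((j : ℝ) / N) ^ a * (1 - (j : ℝ) / N) ^ (M - a)| ≤
      samplingError M N * ((j : ℝ) / N) := by
  have hN' : (0 : ℝ) < N := by exact_mod_cast hN
  have hD : (0 : ℝ) < N.descFactorial M := by exact_mod_cast Nat.descFactorial_pos.2 hM
  obtain ⟨h1, h2⟩ := descFactorial_div_pow_bounds hN hj a
  obtain ⟨h3, h4⟩ := descFactorial_div_pow_bounds hN (Nat.sub_le N j) (M - a)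
  have hx1 : (j : ℝ) / N ≤ 1 := (div_le_one hN').2 (by exact_mod_cast hj)
  have hx0 : 0 ≤ (j : ℝ) / N := by positivity
  have hcast : ((N - j : ℕ) : ℝ) / N = 1 - (j : ℝ) / N := by
    rw [Nat.cast_sub hj]
    field_simp
  rw [hcast] at h3 h4
  set x : ℝ := (j : ℝ) / N
  set P : ℝ := (j.descFactorial a : ℝ) / N ^ a
  set P' : ℝ := ((N - j).descFactorial (M - a) : ℝ) / N ^ (M - a)
  set r : ℝ := (N : ℝ) ^ M / N.descFactorial M with hr
  have hP0 : 0 ≤ P := by positivity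
  have hP'0 : 0 ≤ P' := by positivity
  have hr1 : 1 ≤ r := one_le_pow_div_descFactorial hM
  have hh : hypergeometricWeight M N j a = P * P' * r := by
    have hpow : (N : ℝ) ^ a * N ^ (M - a) = N ^ M := by
      rw [← pow_add, Nat.add_sub_cancel' haM]
    simp only [hypergeometricWeight, P, P', hr]
    push_cast
    rw [← hpow]
    field_simp
  have hxa : x ^ a ≤ x := pow_le_of_le_one hx0 hx1 ha
  have hxb : (1 - x) ^ (M - a) ≤ 1 := pow_le_one₀ (by linarith) (by linarith)
  have hb0 : 0 ≤ (1 - x) ^ (M - a) := pow_nonneg (by linarith) _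
  have hPP : P * P' ≤ x := by
    calc P * P' ≤ x * 1 := mul_le_mul (h1.trans hxa) (h3.trans hxb) hP'0 hx0
      _ = x := mul_one x
  have hMa : (a : ℝ) ^ 2 / N ≤ M ^ 2 / N := by gcongr
  have hMb : ((M - a : ℕ) : ℝ) ^ 2 / N ≤ M ^ 2 / N := by
    gcongr
    exact Nat.sub_le M a
  have hlow : P * P' ≤ x ^ a * (1 - x) ^ (M - a) :=
    mul_le_mul h1 h3 hP'0 (by positivity)
  have hup : x ^ a * (1 - x) ^ (M - a) - P * P' ≤ x * (2 * M ^ 2 / N) := by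
    have e1 : x ^ a * ((1 - x) ^ (M - a) - P') ≤ x * (M ^ 2 / N) := by
      refine mul_le_mul hxa (h4.trans ?_) (by linarith) hx0
      refine (mul_le_of_le_one_left (by positivity) (by linarith)).trans hMb
    have e2 : (x ^ a - P) * P' ≤ x * (M ^ 2 / N) := by
      calc (x ^ a - P) * P' ≤ (x * (M ^ 2 / N)) * 1 := by
            refine mul_le_mul (h2.trans ?_) (h3.trans hxb) hP'0 (by positivity)
            gcongr
        _ = _ := mul_one _
    calc _ = x ^ a * ((1 - x) ^ (M - a) - P') + (x ^ a - P) * P' := by ring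
      _ ≤ x * (M ^ 2 / N) + x * (M ^ 2 / N) := add_le_add e1 e2
      _ = _ := by ring
  rw [hh, samplingError, ← hr, abs_le]
  have e3 : P * P' * (r - 1) ≤ x * (r - 1) := mul_le_mul_of_nonneg_right hPP (by linarith)
  have e4 : 0 ≤ P * P' * (r - 1) := mul_nonneg (by positivity) (by linarith)
  have e5 : 0 ≤ x * (r - 1) := mul_nonneg hx0 (by linarith)
  have e6 : 0 ≤ x * (2 * M ^ 2 / N) := by positivity
  constructor <;> nlinarith

/-- Uniform comparison of sampling without and with replacement. -/
lemma abs_sizeAverage_restrictSteps_sub_edgeGF_le {M N j : ℕ} (hN : 0 < N) (hM : M ≤ N)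
    (hj : j ≤ N) {s : Finset (Fin M) → ℝ≥0} (hs : ∀ A, s A ≤ 1) (h0 : s ∅ = 1) :
    |(sizeAverage (s ∘ restrictSteps hM) j : ℝ) - edgeGF s ((j : ℝ) / N)| ≤
      2 ^ M * samplingError M N * ((j : ℝ) / N) := by
  set d : Finset (Fin M) → ℝ := fun A => hypergeometricWeight M N j A.card -
    ((j : ℝ) / N) ^ A.card * (1 - (j : ℝ) / N) ^ (M - A.card) with hd
  have hsum : ∑ A, d A = 0 := by
    have h1 := sizeAverage_restrictSteps hM (fun _ => 1) hj
    have h2 : sizeAverage ((fun _ => 1) ∘ restrictSteps hM) j = 1 := by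
      have : (N.choose j : ℝ≥0) ≠ 0 := by exact_mod_cast (Nat.choose_pos hj).ne'
      simp [sizeAverage, this]
    rw [h2] at h1
    simp only [NNReal.coe_one, mul_one] at h1
    rw [hd, Finset.sum_sub_distrib, ← h1, sum_pow_card_mul_pow, sub_self]
  have heq : (sizeAverage (s ∘ restrictSteps hM) j : ℝ) - edgeGF s ((j : ℝ) / N) =
      ∑ A, d A * (s A - 1) := by
    rw [sizeAverage_restrictSteps hM s hj, edgeGF, ← Finset.sum_sub_distrib]
    simp only [mul_sub, mul_one, Finset.sum_sub_distrib, hsum, sub_zero]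
    rw [← Finset.sum_sub_distrib]
    exact Finset.sum_congr rfl fun A _ => by rw [hd]; ring
  rw [heq]
  refine (Finset.abs_sum_le_sum_abs _ _).trans ?_
  have hε := samplingError_nonneg hM
  refine (Finset.sum_le_card_nsmul _ _ (samplingError M N * ((j : ℝ) / N)) fun A _ => ?_).trans ?_
  · by_cases hA : A = ∅
    · rw [hA, h0]
      simp only [NNReal.coe_one, sub_self, mul_zero, abs_zero]
      positivity
    · rw [abs_mul]
      have h1 : |(s A : ℝ) - 1| ≤ 1 := by
        have : (s A : ℝ) ≤ 1 := by exact_mod_cast hs A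
        have := (s A).2
        rw [abs_le]
        constructor <;> linarith [NNReal.coe_nonneg (s A)]
      refine (mul_le_of_le_one_right (abs_nonneg _) h1).trans ?_
      exact abs_hypergeometricWeight_sub_le hN hM hj (by simpa using hA)
        (by simpa using A.card_le_univ)
  · simp [mul_assoc]

lemma Multiset.abs_prod_map_sub_prod_map_le {α : Type*} (c : Multiset α) {f g : α → ℝ}
    (hf : ∀ a ∈ c, 0 ≤ f a ∧ f a ≤ 1) (hg : ∀ a ∈ c, 0 ≤ g a ∧ g a ≤ 1) :
    |(c.map f).prod - (c.map g).prod| ≤ (c.map fun a => |f a - g a|).sum ∧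
      0 ≤ (c.map g).prod ∧ (c.map g).prod ≤ 1 := by
  induction c using Multiset.induction with
  | empty => simp
  | cons a c ih =>
    obtain ⟨h1, h2, h3⟩ := ih (fun b hb => hf b (Multiset.mem_cons_of_mem hb))
      fun b hb => hg b (Multiset.mem_cons_of_mem hb)
    obtain ⟨f0, f1⟩ := hf a (Multiset.mem_cons_self a c)
    obtain ⟨g0, g1⟩ := hg a (Multiset.mem_cons_self a c)
    simp only [Multiset.map_cons, Multiset.prod_cons, Multiset.sum_cons]
    refine ⟨?_, mul_nonneg g0 h2, mul_le_one₀ g1 h2 h3⟩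
    rw [show f a * (c.map f).prod - g a * (c.map g).prod =
      (f a - g a) * (c.map g).prod + f a * ((c.map f).prod - (c.map g).prod) by ring]
    refine (abs_add_le _ _).trans (add_le_add ?_ ?_)
    · rw [abs_mul, abs_of_nonneg h2]
      exact mul_le_of_le_one_right (abs_nonneg _) h3
    · rw [abs_mul, abs_of_nonneg f0]
      exact (mul_le_of_le_one_left (abs_nonneg _) f1).trans h1

end Estimate

section CompensatedProduct

variable {M : ℕ} {s : Finset (Fin M) → ℝ≥0}

lemma edgeGF_zero (h0 : s ∅ = 1) : edgeGF s 0 = 1 := by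
  rw [edgeGF, Finset.sum_eq_single ∅]
  · simp [h0]
  · intro A _ hA
    simp [hA]
  · simp

lemma abs_edgeGF_sub_linear_le (hs : ∀ A, s A ≤ 1) (h0 : s ∅ = 1) {v : ℝ} (hv0 : 0 ≤ v)
    (hv1 : v ≤ 1) : |edgeGF s v - (1 - rateGF s * v)| ≤ 2 ^ M * (M + 1) * v ^ 2 := by
  have hrate : rateGF s = ∑ A : Finset (Fin M), if A.card = 1 then 1 - (s A : ℝ) else 0 := by
    rw [← Finset.sum_filter, rateGF]
    refine Finset.sum_bij (fun n _ => {n}) (by simp) (by simp) ?_ (by simp)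
    intro A hA
    obtain ⟨a, rfl⟩ := Finset.card_eq_one.1 (Finset.mem_filter.1 hA).2
    exact ⟨a, by simp, rfl⟩
  have heq : edgeGF s v - (1 - rateGF s * v) = ∑ A : Finset (Fin M),
      ((if A.card = 1 then v else 0) - v ^ A.card * (1 - v) ^ (M - A.card)) * (1 - s A) := by
    have h1 : edgeGF s v = 1 - ∑ A : Finset (Fin M),
        v ^ A.card * (1 - v) ^ (M - A.card) * (1 - s A) := by
      rw [edgeGF]
      simp only [mul_sub, mul_one, Finset.sum_sub_distrib, sum_pow_card_mul_pow]
      ring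
    rw [h1, hrate, Finset.sum_mul]
    simp only [sub_mul _ _ ((1 : ℝ) - _), Finset.sum_sub_distrib]
    have h2 : ∀ A : Finset (Fin M), (if A.card = 1 then 1 - (s A : ℝ) else 0) * v =
        (if A.card = 1 then v else 0) * (1 - s A) := fun A => by
      split_ifs <;> ring
    simp only [h2]
    ring
  rw [heq]
  refine (Finset.abs_sum_le_sum_abs _ _).trans ?_
  refine (Finset.sum_le_card_nsmul _ _ ((M + 1) * v ^ 2) fun A _ => ?_).trans ?_
  · have hsA : (s A : ℝ) ≤ 1 := by exact_mod_cast hs A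
    have hsA0 := NNReal.coe_nonneg (s A)
    have hb0 : 0 ≤ (1 - v) ^ (M - A.card) := pow_nonneg (by linarith) _
    have hb1 : (1 - v) ^ (M - A.card) ≤ 1 := pow_le_one₀ (by linarith) (by linarith)
    rw [abs_mul, abs_of_nonneg (show (0 : ℝ) ≤ 1 - s A by linarith)]
    rcases Nat.lt_trichotomy A.card 1 with h | h | h
    · rw [Finset.card_eq_zero.1 (Nat.lt_one_iff.1 h), h0]
      simp only [NNReal.coe_one, sub_self, mul_zero]
      positivity
    · refine (mul_le_of_le_one_right (abs_nonneg _) (by linarith)).trans ?_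
      rw [if_pos h, h, pow_one]
      have hB := one_add_mul_le_pow (show (-2 : ℝ) ≤ -v by linarith) (M - 1)
      rw [← sub_eq_add_neg 1 v] at hB
      rw [h] at hb1
      have hM : ((M - 1 : ℕ) : ℝ) ≤ M := by exact_mod_cast Nat.sub_le M 1
      have h1 : v * (1 - (1 - v) ^ (M - 1)) ≤ v * (M * v) := by
        refine mul_le_mul_of_nonneg_left ?_ hv0
        have := mul_le_mul_of_nonneg_right hM hv0
        linarith
      rw [show v - v * (1 - v) ^ (M - 1) = v * (1 - (1 - v) ^ (M - 1)) by ring,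
        abs_of_nonneg (mul_nonneg hv0 (by linarith))]
      nlinarith [sq_nonneg v]
    · refine (mul_le_of_le_one_right (abs_nonneg _) (by linarith)).trans ?_
      rw [if_neg h.ne', zero_sub, abs_neg, abs_of_nonneg (by positivity)]
      have h2 : v ^ A.card ≤ v ^ 2 := pow_le_pow_of_le_one hv0 hv1 h
      have h3 : v ^ A.card * (1 - v) ^ (M - A.card) ≤ v ^ 2 * 1 :=
        mul_le_mul h2 hb1 hb0 (sq_nonneg v)
      have : (0 : ℝ) ≤ M * v ^ 2 := by positivity
      linarith
  · simp [mul_assoc]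

/-- The generating function of one edge, compensated to be `1` up to second order. -/
noncomputable def compensatedGF (s : Finset (Fin M) → ℝ≥0) (v : ℝ) : ℝ :=
  edgeGF s v * Real.exp (rateGF s * v)

lemma exists_abs_compensatedGF_sub_one_le (hs : ∀ A, s A ≤ 1) (h0 : s ∅ = 1) :
    ∃ C : ℝ, 0 ≤ C ∧ ∀ v : ℝ, 0 ≤ v → v ≤ 1 → |compensatedGF s v - 1| ≤ C * v ^ 2 := by
  have hc := rateGF_nonneg hs
  refine ⟨Real.exp (rateGF s) * (2 ^ M * (M + 1) + rateGF s ^ 2), by positivity,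
    fun v hv0 hv1 => ?_⟩
  have h1 := abs_edgeGF_sub_linear_le hs h0 hv0 hv1
  set c := rateGF s
  have hx0 : 0 ≤ c * v := by positivity
  have hexp : Real.exp (c * v) ≤ Real.exp c := Real.exp_le_exp.2 (mul_le_of_le_one_right hc hv1)
  have hpos := Real.exp_pos (c * v)
  have h2 : |(1 - c * v) * Real.exp (c * v) - 1| ≤ Real.exp (c * v) * (c * v) ^ 2 := by
    have e1 : 1 - c * v ≤ Real.exp (-(c * v)) := by
      linarith [Real.add_one_le_exp (-(c * v))]
    have e2 : Real.exp (-(c * v)) ≤ 1 - c * v + (c * v) ^ 2 := by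
      rw [Real.exp_neg, inv_le_iff_one_le_mul₀ hpos]
      have := Real.add_one_le_exp (c * v)
      have h3 : 0 ≤ 1 - c * v + (c * v) ^ 2 := by nlinarith [sq_nonneg (c * v - 1)]
      have h4 := mul_le_mul_of_nonneg_left this h3
      nlinarith [pow_nonneg hx0 3]
    have e3 : Real.exp (-(c * v)) * Real.exp (c * v) = 1 := by
      rw [← Real.exp_add]
      simp
    have e4 := mul_le_mul_of_nonneg_right e1 hpos.le
    have e5 := mul_le_mul_of_nonneg_right e2 hpos.le
    rw [e3] at e4 e5
    rw [abs_le]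
    constructor
    · nlinarith
    · have : 0 ≤ Real.exp (c * v) * (c * v) ^ 2 := by positivity
      linarith
  have heq : compensatedGF s v - 1 = (edgeGF s v - (1 - c * v)) * Real.exp (c * v) +
      ((1 - c * v) * Real.exp (c * v) - 1) := by
    rw [compensatedGF]
    ring
  rw [heq]
  calc _ ≤ _ := abs_add_le _ _
    _ ≤ 2 ^ M * (M + 1) * v ^ 2 * Real.exp (c * v) + Real.exp (c * v) * (c * v) ^ 2 := by
        refine add_le_add ?_ h2
        rw [abs_mul, abs_of_pos hpos]
        exact mul_le_mul_of_nonneg_right h1 hpos.le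
    _ = Real.exp (c * v) * ((2 ^ M * (M + 1) + c ^ 2) * v ^ 2) := by ring
    _ ≤ Real.exp c * ((2 ^ M * (M + 1) + c ^ 2) * v ^ 2) := by gcongr
    _ = _ := by ring

end CompensatedProduct

section MassSpace

/-- Decreasing sequences of frequencies together with a bound on their sum. -/
def massSet : Set ((ℕ → I) × ℝ≥0) :=
  {x | Antitone x.1 ∧ ∀ K, ∑ k ∈ Finset.range K, (x.1 k : ℝ) ≤ x.2}

lemma isClosed_massSet : IsClosed massSet := by
  have h1 : IsClosed {x : (ℕ → I) × ℝ≥0 | Antitone x.1} := by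
    simp only [Antitone, Set.ofPred_forall]
    refine isClosed_iInter fun i => isClosed_iInter fun j => isClosed_iInter fun _ => ?_
    exact isClosed_le (by fun_prop) (by fun_prop)
  have h2 : IsClosed {x : (ℕ → I) × ℝ≥0 | ∀ K, ∑ k ∈ Finset.range K, (x.1 k : ℝ) ≤ x.2} := by
    simp only [Set.ofPred_forall]
    exact isClosed_iInter fun K => isClosed_le (by fun_prop) (by fun_prop)
  exact h1.inter h2

variable {x : (ℕ → I) × ℝ≥0}

lemma summable_of_mem_massSet (hx : x ∈ massSet) : Summable fun k => (x.1 k : ℝ) :=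
  summable_of_sum_range_le (fun k => (x.1 k).2.1) hx.2

lemma le_div_of_mem_massSet (hx : x ∈ massSet) (k : ℕ) : (x.1 k : ℝ) ≤ x.2 / (k + 1) := by
  rw [le_div_iff₀ (by positivity)]
  refine le_trans ?_ (hx.2 (k + 1))
  have := Finset.card_nsmul_le_sum (Finset.range (k + 1)) (fun i => (x.1 i : ℝ)) (x.1 k)
    fun i hi => hx.1 (Nat.lt_succ_iff.1 (Finset.mem_range.1 hi))
  simpa [mul_comm] using this

variable {M : ℕ} {s : Finset (Fin M) → ℝ≥0}

/-- Partial products of the generating function given the frequencies and the total mass. -/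
noncomputable def partialGF (s : Finset (Fin M) → ℝ≥0) (K : ℕ) (x : (ℕ → I) × ℝ≥0) : ℝ :=
  Real.exp (-(rateGF s * x.2)) * ∏ k ∈ Finset.range K, compensatedGF s (x.1 k)

/-- The generating function given the frequencies and the total mass. -/
noncomputable def limitGF (s : Finset (Fin M) → ℝ≥0) (x : (ℕ → I) × ℝ≥0) : ℝ :=
  partialGF s 0 x + ∑' K, (partialGF s (K + 1) x - partialGF s K x)

lemma continuous_partialGF (s : Finset (Fin M) → ℝ≥0) (K : ℕ) : Continuous (partialGF s K) := by
  have : Continuous (compensatedGF s) :=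
    (continuous_edgeGF s).mul (by fun_prop)
  unfold partialGF
  fun_prop

lemma partialGF_eq (s : Finset (Fin M) → ℝ≥0) (K : ℕ) (x : (ℕ → I) × ℝ≥0) :
    partialGF s K x = Real.exp (-(rateGF s * (x.2 - ∑ k ∈ Finset.range K, (x.1 k : ℝ)))) *
      ∏ k ∈ Finset.range K, edgeGF s (x.1 k) := by
  simp only [partialGF, compensatedGF]
  rw [Finset.prod_mul_distrib, ← Real.exp_sum, ← Finset.mul_sum, mul_comm (∏ k ∈ _, _),
    ← mul_assoc, ← Real.exp_add]
  ring_nf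

lemma partialGF_mem_Icc (hs : ∀ A, s A ≤ 1) (hx : x ∈ massSet) (K : ℕ) :
    0 ≤ partialGF s K x ∧ partialGF s K x ≤ 1 := by
  rw [partialGF_eq]
  have h1 : ∀ k, 0 ≤ edgeGF s (x.1 k) := fun k => edgeGF_nonneg s (x.1 k).2.1 (x.1 k).2.2
  have h2 : ∏ k ∈ Finset.range K, edgeGF s (x.1 k) ≤ 1 :=
    Finset.prod_le_one (fun k _ => h1 k) fun k _ => edgeGF_le_one hs (x.1 k).2.1 (x.1 k).2.2
  have h3 : 0 ≤ ∏ k ∈ Finset.range K, edgeGF s (x.1 k) := Finset.prod_nonneg fun k _ => h1 k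
  refine ⟨by positivity, mul_le_one₀ ?_ h3 h2⟩
  rw [Real.exp_le_one_iff, neg_nonpos]
  exact mul_nonneg (rateGF_nonneg hs) (sub_nonneg.2 (hx.2 K))

lemma abs_partialGF_succ_sub_le (hs : ∀ A, s A ≤ 1) {C : ℝ} (hC0 : 0 ≤ C)
    (hC : ∀ v : ℝ, 0 ≤ v → v ≤ 1 → |compensatedGF s v - 1| ≤ C * v ^ 2) (hx : x ∈ massSet)
    {T : ℝ} (hT : (x.2 : ℝ) ≤ T) (K : ℕ) :
    |partialGF s (K + 1) x - partialGF s K x| ≤ C * T ^ 2 * (1 / ((K : ℝ) + 1) ^ 2) := by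
  have h1 : partialGF s (K + 1) x - partialGF s K x =
      partialGF s K x * (compensatedGF s (x.1 K) - 1) := by
    rw [partialGF, partialGF, Finset.prod_range_succ]
    ring
  obtain ⟨h2, h3⟩ := partialGF_mem_Icc hs hx K
  rw [h1, abs_mul, abs_of_nonneg h2]
  refine (mul_le_of_le_one_left (abs_nonneg _) h3).trans ?_
  refine (hC _ (x.1 K).2.1 (x.1 K).2.2).trans ?_
  rw [mul_assoc]
  refine mul_le_mul_of_nonneg_left ?_ hC0
  rw [mul_one_div, ← div_pow]
  refine pow_le_pow_left₀ (x.1 K).2.1 ((le_div_of_mem_massSet hx K).trans ?_) 2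
  gcongr

lemma summable_mul_one_div_succ_sq (C : ℝ) :
    Summable fun K : ℕ => C * (1 / ((K : ℝ) + 1) ^ 2) := by
  have := (summable_nat_add_iff 1).2 (Real.summable_one_div_nat_pow.2 (by norm_num : 1 < 2))
  refine Summable.mul_left C ?_
  simpa using this

lemma tendsto_partialGF (hs : ∀ A, s A ≤ 1) (h0 : s ∅ = 1) (hx : x ∈ massSet) :
    Filter.Tendsto (fun K => partialGF s K x) Filter.atTop (nhds (limitGF s x)) := by
  obtain ⟨C, hC0, hC⟩ := exists_abs_compensatedGF_sub_one_le hs h0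
  have hsum : Summable fun K => partialGF s (K + 1) x - partialGF s K x :=
    Summable.of_norm_bounded (summable_mul_one_div_succ_sq (C * (x.2 : ℝ) ^ 2)) fun K =>
      abs_partialGF_succ_sub_le hs hC0 hC hx le_rfl K
  have h := hsum.hasSum.tendsto_sum_nat.const_add (partialGF s 0 x)
  simp only [Finset.sum_range_sub (fun K => partialGF s K x), add_sub_cancel] at h
  exact h

lemma limitGF_mem_Icc (hs : ∀ A, s A ≤ 1) (h0 : s ∅ = 1) (hx : x ∈ massSet) :
    0 ≤ limitGF s x ∧ limitGF s x ≤ 1 :=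
  ⟨ge_of_tendsto' (tendsto_partialGF hs h0 hx) fun K => (partialGF_mem_Icc hs hx K).1,
    le_of_tendsto' (tendsto_partialGF hs h0 hx) fun K => (partialGF_mem_Icc hs hx K).2⟩

lemma continuous_limitGF (hs : ∀ A, s A ≤ 1) (h0 : s ∅ = 1) :
    Continuous fun x : massSet => limitGF s x := by
  obtain ⟨C, hC0, hC⟩ := exists_abs_compensatedGF_sub_one_le hs h0
  rw [continuous_iff_continuousAt]
  intro x
  let T : ℝ := x.1.2 + 1
  have hopen : IsOpen {y : massSet | (y.1.2 : ℝ) < T} :=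
    isOpen_lt (by fun_prop) continuous_const
  have hpart : ∀ K, Continuous fun y : massSet => partialGF s K y := fun K =>
    (continuous_partialGF s K).comp continuous_subtype_val
  have hon : ContinuousOn (fun y : massSet => limitGF s y) {y : massSet | (y.1.2 : ℝ) < T} := by
    unfold limitGF
    refine (hpart 0).continuousOn.add ?_
    refine continuousOn_tsum (fun K => ((hpart (K + 1)).sub (hpart K)).continuousOn)
      (summable_mul_one_div_succ_sq (C * T ^ 2)) ?_
    intro K y hy
    exact abs_partialGF_succ_sub_le hs hC0 hC y.2 (le_of_lt hy) K
  exact hon.continuousAt (hopen.mem_nhds (show (x.1.2 : ℝ) < x.1.2 + 1 by linarith))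

/-- The mass not accounted for by the frequencies. -/
noncomputable def dust (x : (ℕ → I) × ℝ≥0) : ℝ≥0 := (x.2 - ∑' k, (x.1 k : ℝ)).toNNReal

lemma measurable_dust : Measurable dust := by
  unfold dust
  have : Measurable fun x : (ℕ → I) × ℝ≥0 => ∑' k, (x.1 k : ℝ) :=
    Measurable.tsum fun k => by fun_prop
  fun_prop

lemma coe_dust (hx : x ∈ massSet) : (dust x : ℝ) = x.2 - ∑' k, (x.1 k : ℝ) :=
  Real.coe_toNNReal _ (sub_nonneg.2 (Real.tsum_le_of_sum_range_le (fun k => (x.1 k).2.1) hx.2))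

lemma tendsto_dust_product (hs : ∀ A, s A ≤ 1) (h0 : s ∅ = 1) (hx : x ∈ massSet) :
    Filter.Tendsto (fun K => Real.exp (-(dust x * rateGF s)) *
      ∏ k ∈ Finset.range K, edgeGF s (x.1 k)) Filter.atTop (nhds (limitGF s x)) := by
  have h1 := (summable_of_mem_massSet hx).hasSum.tendsto_sum_nat
  have h2 : Filter.Tendsto (fun K => Real.exp (rateGF s *
      (∑' k, (x.1 k : ℝ) - ∑ k ∈ Finset.range K, (x.1 k : ℝ)))) Filter.atTop (nhds 1) := by
    have := ((h1.const_sub (∑' k, (x.1 k : ℝ))).const_mul (rateGF s))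
    rw [sub_self, mul_zero] at this
    simpa [Function.comp_def] using (Real.continuous_exp.tendsto 0).comp this
  have h3 := h2.mul (tendsto_partialGF hs h0 hx)
  rw [one_mul] at h3
  refine h3.congr fun K => ?_
  rw [partialGF_eq, ← mul_assoc, ← Real.exp_add, coe_dust hx]
  ring_nf

end MassSpace

section SamplePoint

@[to_additive]
lemma List.prod_range_getD {β : Type*} [CommMonoid β] (f : ℕ → β) (hf : f 0 = 1) (l : List ℕ)
    {K : ℕ} (hK : l.length ≤ K) : ∏ k ∈ Finset.range K, f (l.getD k 0) = (l.map f).prod := by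
  induction l generalizing K with
  | nil => simp [hf]
  | cons a l ih =>
    obtain ⟨K', rfl⟩ : ∃ K', K = K' + 1 := ⟨K - 1, by simp at hK; omega⟩
    rw [Finset.prod_range_succ']
    simp only [List.getD_cons_succ, List.getD_cons_zero, List.map_cons, List.prod_cons]
    rw [ih (by simpa using hK), mul_comm]

lemma List.Pairwise.antitone_getD {l : List ℕ} (hl : l.Pairwise (· ≥ ·)) :
    Antitone fun k => l.getD k 0 := by
  intro i j hij
  rcases lt_or_ge j l.length with hj | hj
  · rcases hij.eq_or_lt with rfl | hlt
    · exact le_rfl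
    · simp only [List.getD_eq_getElem _ _ hj, List.getD_eq_getElem _ _ (hlt.trans hj)]
      exact List.pairwise_iff_getElem.1 hl i j (hlt.trans hj) hj hlt
  · simp only [List.getD_eq_default _ _ hj]
    exact Nat.zero_le _

variable {N : ℕ}

/-- The sizes of the sets in a step collection, in decreasing order. -/
noncomputable def sortedSizes (c : StepCollection N) : List ℕ :=
  (c.map Finset.card).sort (· ≥ ·)

lemma coe_sortedSizes (c : StepCollection N) :
    (sortedSizes c : Multiset ℕ) = c.map Finset.card :=
  Multiset.sort_eq _ _

lemma getD_sortedSizes_le (c : StepCollection N) (k : ℕ) : (sortedSizes c).getD k 0 ≤ N := by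
  rcases lt_or_ge k (sortedSizes c).length with hk | hk
  · rw [List.getD_eq_getElem _ _ hk]
    have h1 : (sortedSizes c)[k] ∈ (sortedSizes c : Multiset ℕ) := List.getElem_mem hk
    rw [coe_sortedSizes, Multiset.mem_map] at h1
    obtain ⟨A, -, hA⟩ := h1
    rw [← hA]
    simpa using A.card_le_univ
  · rw [List.getD_eq_default _ _ hk]
    exact Nat.zero_le _

/-- The empirical frequencies of the edges, in decreasing order. -/
noncomputable def sampleFreq (c : StepCollection N) (k : ℕ) : I :=
  ⟨((sortedSizes c).getD k 0 : ℝ) / N, by positivity,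
    div_le_one_of_le₀ (by exact_mod_cast getD_sortedSizes_le c k) (by positivity)⟩

/-- The average number of edges per step. -/
noncomputable def sampleMass (c : StepCollection N) : ℝ≥0 :=
  ((c.map Finset.card).sum : ℝ≥0) / N

lemma coe_sampleMass (c : StepCollection N) :
    (sampleMass c : ℝ) = (c.map fun A => (A.card : ℝ) / N).sum := by
  rw [sampleMass, NNReal.coe_div, NNReal.coe_natCast, NNReal.coe_natCast, Nat.cast_multiset_sum,
    Multiset.map_map, Multiset.sum_map_div]
  rfl

lemma sum_range_sampleFreq (c : StepCollection N) {K : ℕ} (hK : (sortedSizes c).length ≤ K) :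
    ∑ k ∈ Finset.range K, (sampleFreq c k : ℝ) = sampleMass c := by
  have h := List.sum_range_getD (fun j : ℕ => (j : ℝ) / N) (by simp) (sortedSizes c) hK
  have h2 : ((sortedSizes c).map fun j : ℕ => (j : ℝ) / N).sum = sampleMass c := by
    rw [coe_sampleMass, ← Multiset.sum_coe, ← Multiset.map_coe, coe_sortedSizes, Multiset.map_map]
    rfl
  rw [← h2, ← h]
  rfl

lemma sample_mem_massSet (c : StepCollection N) : (sampleFreq c, sampleMass c) ∈ massSet := by
  refine ⟨fun i j hij => ?_, fun K => ?_⟩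
  · rw [← Subtype.coe_le_coe]
    simp only [sampleFreq]
    gcongr
    exact (Multiset.pairwise_sort (c.map Finset.card) (· ≥ ·)).antitone_getD hij
  · rw [← sum_range_sampleFreq c (le_max_right K (sortedSizes c).length)]
    refine Finset.sum_le_sum_of_subset_of_nonneg ?_ fun k _ _ => (sampleFreq c k).2.1
    exact Finset.range_subset_range.2 (le_max_left _ _)

/-- The empirical frequencies and the average number of edges per step. -/
noncomputable def samplePoint (c : StepCollection N) : massSet :=
  ⟨(sampleFreq c, sampleMass c), sample_mem_massSet c⟩

lemma limitGF_samplePoint {M : ℕ} {s : Finset (Fin M) → ℝ≥0} (hs : ∀ A, s A ≤ 1)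
    (h0 : s ∅ = 1) (c : StepCollection N) :
    limitGF s (samplePoint c) = (c.map fun A => edgeGF s ((A.card : ℝ) / N)).prod := by
  refine tendsto_nhds_unique (tendsto_partialGF hs h0 (samplePoint c).2) ?_
  refine tendsto_nhds_of_eventually_eq ?_
  filter_upwards [Filter.eventually_ge_atTop (sortedSizes c).length] with K hK
  rw [partialGF_eq]
  simp only [samplePoint]
  rw [sum_range_sampleFreq c hK, sub_self, mul_zero, neg_zero, Real.exp_zero, one_mul]
  have h := List.prod_range_getD (fun j : ℕ => edgeGF s ((j : ℝ) / N)) (by simp [edgeGF_zero h0])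
    (sortedSizes c) hK
  rw [← Multiset.prod_coe, ← Multiset.map_coe, coe_sortedSizes, Multiset.map_map] at h
  exact h

lemma coe_weight_real (s : Finset (Fin N) → ℝ≥0) (c : StepCollection N) :
    (c.weight s : ℝ) = (c.map fun A => (s A : ℝ)).prod := by
  rw [StepCollection.weight]
  exact (map_multiset_prod NNReal.toRealHom _).trans (by rw [Multiset.map_map]; rfl)

/-- Comparison of the conditional generating functions for sampling without and with
replacement. -/
lemma abs_weight_sub_limitGF_le {M : ℕ} {s : Finset (Fin M) → ℝ≥0} (hs : ∀ A, s A ≤ 1)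
    (h0 : s ∅ = 1) (hN : 0 < N) (hM : M ≤ N) (c : StepCollection N) :
    |(c.weight (fun A => sizeAverage (s ∘ restrictSteps hM) A.card) : ℝ) -
      limitGF s (samplePoint c)| ≤ 2 ^ M * samplingError M N * sampleMass c := by
  rw [limitGF_samplePoint hs h0, coe_weight_real]
  have hcard : ∀ A : Finset (Fin N), A.card ≤ N := fun A => by simpa using A.card_le_univ
  refine (Multiset.abs_prod_map_sub_prod_map_le c (fun A _ => ⟨NNReal.coe_nonneg _, ?_⟩)
    fun A _ => ?_).1.trans ?_
  · exact_mod_cast sizeAverage_le_one (fun B => hs _) _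
  · have h1 : (A.card : ℝ) / N ≤ 1 :=
      div_le_one_of_le₀ (by exact_mod_cast hcard A) (by positivity)
    exact ⟨edgeGF_nonneg s (by positivity) h1, edgeGF_le_one hs (by positivity) h1⟩
  · rw [coe_sampleMass, ← Multiset.sum_map_mul_left]
    refine Multiset.sum_map_le_sum_map _ _ fun A _ => ?_
    exact abs_sizeAverage_restrictSteps_sub_edgeGF_le hN hM (hcard A) hs h0

/-- The variables that count the edges of the first step. -/
noncomputable def firstStepVar (t : ℝ≥0) (A : Finset (Fin 1)) : ℝ≥0 := if A = ∅ then 1 else t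

lemma sizeAverage_firstStepVar (hN : 1 ≤ N) (t : ℝ≥0) {j : ℕ} (hj : j ≤ N) :
    (sizeAverage (firstStepVar t ∘ restrictSteps hN) j : ℝ) = 1 - (1 - t) * ((j : ℝ) / N) := by
  rw [sizeAverage_restrictSteps hN _ hj]
  have huniv : (Finset.univ : Finset (Finset (Fin 1))) = {∅, {0}} := by decide
  have hN' : (N : ℝ) ≠ 0 := by positivity
  rw [huniv, Finset.sum_pair (by simp)]
  simp only [hypergeometricWeight, firstStepVar]
  simp [Nat.cast_sub hj]
  field_simp
  ring

lemma weight_firstStepVar_le (hN : 1 ≤ N) (t : ℝ≥0) (c : StepCollection N) :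
    (c.weight (fun A => sizeAverage (firstStepVar t ∘ restrictSteps hN) A.card) : ℝ) ≤
      Real.exp (-((1 - t) * sampleMass c)) := by
  rw [coe_weight_real, coe_sampleMass]
  have hcard : ∀ A : Finset (Fin N), A.card ≤ N := fun A => by simpa using A.card_le_univ
  induction c using Multiset.induction with
  | empty => simp
  | cons A c ih =>
    simp only [Multiset.map_cons, Multiset.prod_cons, Multiset.sum_cons]
    rw [mul_add, neg_add, Real.exp_add]
    refine mul_le_mul ?_ ih ?_ (Real.exp_pos _).le
    · rw [sizeAverage_firstStepVar hN t (hcard A)]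
      linarith [Real.add_one_le_exp (-((1 - (t : ℝ)) * ((A.card : ℝ) / N)))]
    · exact Multiset.prod_nonneg fun a ha => by
        obtain ⟨B, -, rfl⟩ := Multiset.mem_map.1 ha
        exact NNReal.coe_nonneg _

end SamplePoint

section Limit

variable {Ω W : Type*} [MeasurableSpace Ω] {μ : Measure Ω}
  {G : Ω → GraphSeq W}

lemma integrable_of_mem_Icc {Ω : Type*} [MeasurableSpace Ω] {μ : Measure Ω} [IsFiniteMeasure μ]
    {f : Ω → ℝ} (hf : AEStronglyMeasurable f μ) (h : ∀ ω, 0 ≤ f ω ∧ f ω ≤ 1) : Integrable f μ :=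
  Integrable.of_bound hf 1 (Filter.Eventually.of_forall fun ω => by
    rw [Real.norm_eq_abs, abs_of_nonneg (h ω).1]
    exact (h ω).2)

lemma aestronglyMeasurable_comp_stepCollection {N : ℕ}
    (hm : AEMeasurable (fun ω => stepCollection (G ω) N) μ) (f : StepCollection N → ℝ) :
    AEStronglyMeasurable (fun ω => f (stepCollection (G ω) N)) μ :=
  ((Measurable.of_discrete (f := f)).comp_aemeasurable hm).aestronglyMeasurable

lemma integral_indicator_stepCollection {N : ℕ}
    (hm : AEMeasurable (fun ω => stepCollection (G ω) N) μ) (S : Set (StepCollection N)) :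
    ∫ ω, S.indicator (fun _ => (1 : ℝ)) (stepCollection (G ω) N) ∂μ =
      μ.real {ω | stepCollection (G ω) N ∈ S} := by
  rw [← integral_map (f := S.indicator fun _ => (1 : ℝ)) hm (by fun_prop),
    integral_indicator_const _ MeasurableSet.of_discrete, smul_eq_mul, mul_one,
    map_measureReal_apply_of_aemeasurable hm MeasurableSet.of_discrete]
  rfl

lemma indicator_one_mem_Icc {α : Type*} (S : Set α) (a : α) :
    0 ≤ S.indicator (fun _ => (1 : ℝ)) a ∧ S.indicator (fun _ => (1 : ℝ)) a ≤ 1 := by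
  by_cases ha : a ∈ S <;> simp [ha]

lemma coe_weight_mem_Icc {N : ℕ} {s : Finset (Fin N) → ℝ≥0} (hs : ∀ A, s A ≤ 1)
    (c : StepCollection N) : 0 ≤ (c.weight s : ℝ) ∧ (c.weight s : ℝ) ≤ 1 :=
  ⟨NNReal.coe_nonneg _, by exact_mod_cast StepCollection.weight_le_one hs c⟩

lemma HasEGPF.integral_weight_eq [IsProbabilityMeasure μ] (h : HasEGPF μ G) {M N : ℕ} (hM : M ≤ N)
    {s : Finset (Fin M) → ℝ≥0} (hs : ∀ A, s A ≤ 1) (h0 : s ∅ = 1) :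
    ∫ ω, ((stepCollection (G ω) M).weight s : ℝ) ∂μ = ∫ ω, ((stepCollection (G ω) N).weight
      (fun A => sizeAverage (s ∘ restrictSteps hM) A.card) : ℝ) ∂μ := by
  have hm := h.1.aemeasurable N
  have hp : IsProbabilityMeasure (μ.map fun ω => stepCollection (G ω) N) :=
    Measure.isProbabilityMeasure_map hm
  have h1 := (dependsOnSizes_iff _).1 (h.dependsOnSizes N) (s ∘ restrictSteps hM) fun A => hs _
  have h2 : ∀ s : Finset (Fin N) → ℝ≥0, ∫ ω, ((stepCollection (G ω) N).weight s : ℝ) ∂μ =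
      (∫⁻ c, c.weight s ∂(μ.map fun ω => stepCollection (G ω) N)).toReal := fun s => by
    rw [← _root_.integral_weight_eq, integral_map hm (by fun_prop)]
  rw [h2, ← h1, ← h2]
  refine integral_congr_ae (Filter.Eventually.of_forall fun ω => ?_)
  simp only
  rw [← stepCollection_restrict (G ω) hM, StepCollection.weight_restrict h0]

/-- Tightness of the average number of edges per step. -/
lemma HasEGPF.exists_measureReal_sampleMass_le [IsProbabilityMeasure μ] (h : HasEGPF μ G) {δ : ℝ} (hδ : 0 < δ) :
    ∃ T : ℝ≥0, ∀ N, 1 ≤ N → μ.real {ω | T < sampleMass (stepCollection (G ω) N)} ≤ δ := by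
  let t : ℕ → ℝ≥0 := fun i => 1 - 1 / ((i : ℝ≥0) + 1)
  have ht1 : ∀ i, t i ≤ 1 := fun i => tsub_le_self
  have htv : ∀ i, (t i : ℝ) = 1 - 1 / ((i : ℝ) + 1) := fun i => by
    have : 1 / ((i : ℝ≥0) + 1) ≤ 1 := div_le_one_of_le₀ (by simp) zero_le
    simp only [t]
    rw [NNReal.coe_sub this]
    push_cast
    rfl
  have hvar : ∀ i A, firstStepVar (t i) A ≤ 1 := fun i A => by
    unfold firstStepVar
    split_ifs
    exacts [le_rfl, ht1 i]
  have htend : Filter.Tendsto (fun i => (t i : ℝ)) Filter.atTop (nhds 1) := by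
    simp only [htv]
    simpa using (tendsto_one_div_add_atTop_nhds_zero_nat (𝕜 := ℝ)).const_sub 1
  have hlim : Filter.Tendsto (fun i => ∫ ω, ((stepCollection (G ω) 1).weight
      (firstStepVar (t i)) : ℝ) ∂μ) Filter.atTop (nhds (∫ _, (1 : ℝ) ∂μ)) := by
    refine tendsto_integral_of_dominated_convergence (fun _ => 1)
      (fun i => aestronglyMeasurable_comp_stepCollection (h.1.aemeasurable 1)
        fun c => (c.weight (firstStepVar (t i)) : ℝ)) (integrable_const 1) (fun i => ?_) ?_
    · refine Filter.Eventually.of_forall fun ω => ?_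
      rw [Real.norm_eq_abs, abs_of_nonneg (NNReal.coe_nonneg _)]
      exact (coe_weight_mem_Icc (hvar i) _).2
    · refine Filter.Eventually.of_forall fun ω => ?_
      simp only [coe_weight_real]
      generalize stepCollection (G ω) 1 = c
      induction c using Multiset.induction with
      | empty => simp
      | cons A c ih =>
        simp only [Multiset.map_cons, Multiset.prod_cons]
        have hA : Filter.Tendsto (fun i => (firstStepVar (t i) A : ℝ)) Filter.atTop (nhds 1) := by
          unfold firstStepVar
          split_ifs
          · simp
          · exact htend
        simpa using hA.mul ih
  rw [integral_const] at hlim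
  simp only [probReal_univ, smul_eq_mul, mul_one] at hlim
  obtain ⟨i, hi⟩ := (hlim.eventually (lt_mem_nhds (show 1 - δ / 2 < 1 by linarith))).exists
  refine ⟨i + 1, fun N hN => ?_⟩
  rw [h.integral_weight_eq hN (hvar i) (by simp [firstStepVar])] at hi
  have hm := h.1.aemeasurable N
  have hle : ∀ c : StepCollection N,
      Set.indicator {c : StepCollection N | ((i : ℝ≥0) + 1) < sampleMass c} (fun _ => (1 : ℝ)) c ≤
      2 * (1 - (c.weight (fun A => sizeAverage (firstStepVar (t i) ∘ restrictSteps hN) A.card) :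
        ℝ)) := by
    intro c
    have hw := coe_weight_mem_Icc (fun A : Finset (Fin N) =>
      sizeAverage_le_one (s := firstStepVar (t i) ∘ restrictSteps hN) (fun B => hvar i _) A.card) c
    by_cases hc : ((i : ℝ≥0) + 1) < sampleMass c
    · rw [Set.indicator_of_mem (show c ∈ {c : StepCollection N | ((i : ℝ≥0) + 1) < sampleMass c}
        from hc)]
      have hc' : ((i : ℝ) + 1) < sampleMass c := by exact_mod_cast hc
      have h1 := weight_firstStepVar_le hN (t i) c
      have h2 : (1 : ℝ) ≤ (1 - t i) * sampleMass c := by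
        rw [htv, sub_sub_cancel, one_div, ← div_eq_inv_mul, le_div_iff₀ (by positivity)]
        linarith
      have h3 : Real.exp (-((1 - t i) * sampleMass c)) ≤ Real.exp (-1) :=
        Real.exp_le_exp.2 (by linarith)
      have h4 : Real.exp (-1) ≤ 1 / 2 := by
        rw [Real.exp_neg, one_div]
        exact inv_anti₀ (by norm_num) (by linarith [Real.add_one_le_exp (1 : ℝ)])
      linarith
    · rw [Set.indicator_of_notMem (show c ∉ {c : StepCollection N | ((i : ℝ≥0) + 1) < sampleMass c}
        from hc)]
      linarith [hw.2]
  have hint := integrable_of_mem_Icc (aestronglyMeasurable_comp_stepCollection hm fun c =>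
    (c.weight (fun A => sizeAverage (firstStepVar (t i) ∘ restrictSteps hN) A.card) : ℝ))
    fun ω => coe_weight_mem_Icc (fun A : Finset (Fin N) =>
      sizeAverage_le_one (s := firstStepVar (t i) ∘ restrictSteps hN) (fun B => hvar i _) A.card) _
  have h5 := integral_indicator_stepCollection hm
    {c : StepCollection N | ((i : ℝ≥0) + 1) < sampleMass c}
  simp only [Set.mem_ofPred_eq] at h5
  rw [← h5]
  refine (integral_mono (integrable_of_mem_Icc (aestronglyMeasurable_comp_stepCollection hm _)
    fun ω => indicator_one_mem_Icc _ _) (((integrable_const (1 : ℝ)).sub hint).const_mul 2)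
    fun ω => hle _).trans ?_
  simp only [Pi.sub_apply]
  rw [integral_const_mul, integral_sub (integrable_const _) hint, integral_const]
  simp only [probReal_univ, smul_eq_mul, mul_one]
  linarith

/-- The generating functions are approximated by those of the empirical frequencies. -/
lemma HasEGPF.tendsto_integral_limitGF [IsProbabilityMeasure μ] (h : HasEGPF μ G) {M : ℕ} {s : Finset (Fin M) → ℝ≥0}
    (hs : ∀ A, s A ≤ 1) (h0 : s ∅ = 1) :
    Filter.Tendsto (fun N => ∫ ω, limitGF s (samplePoint (stepCollection (G ω) N)) ∂μ)
      Filter.atTop (nhds (∫ ω, ((stepCollection (G ω) M).weight s : ℝ) ∂μ)) := by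
  rw [Metric.tendsto_atTop]
  intro δ hδ
  obtain ⟨T, hT⟩ := h.exists_measureReal_sampleMass_le (half_pos hδ)
  have herr : Filter.Tendsto (fun N => 2 ^ M * samplingError M N * (T : ℝ)) Filter.atTop
      (nhds 0) := by
    simpa using ((tendsto_samplingError M).const_mul (2 ^ M)).mul_const (T : ℝ)
  obtain ⟨N₀, hN₀⟩ := Filter.eventually_atTop.1
    (herr.eventually (gt_mem_nhds (half_pos hδ)))
  refine ⟨max N₀ (max M 1), fun N hN => ?_⟩
  have hN1 : 1 ≤ N := (le_max_right M 1).trans ((le_max_right _ _).trans hN)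
  have hM : M ≤ N := (le_max_left M 1).trans ((le_max_right _ _).trans hN)
  have herrN := hN₀ N ((le_max_left _ _).trans hN)
  have hm := h.1.aemeasurable N
  rw [h.integral_weight_eq hM hs h0, dist_comm, Real.dist_eq]
  have hwI := fun c : StepCollection N => coe_weight_mem_Icc (fun A : Finset (Fin N) =>
    sizeAverage_le_one (s := s ∘ restrictSteps hM) (fun B => hs _) A.card) c
  have hlI := fun c : StepCollection N => limitGF_mem_Icc hs h0 (samplePoint c).2
  have hi1 := integrable_of_mem_Icc (aestronglyMeasurable_comp_stepCollection hm fun c =>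
    (c.weight (fun A => sizeAverage (s ∘ restrictSteps hM) A.card) : ℝ)) fun ω => hwI _
  have hi2 := integrable_of_mem_Icc (aestronglyMeasurable_comp_stepCollection hm fun c =>
    limitGF s (samplePoint c)) fun ω => hlI _
  rw [← integral_sub hi1 hi2]
  have hi3 := integrable_of_mem_Icc (aestronglyMeasurable_comp_stepCollection hm
    ({c : StepCollection N | T < sampleMass c}.indicator fun _ => (1 : ℝ)))
    fun ω => indicator_one_mem_Icc _ _
  have hε := samplingError_nonneg hM
  calc _ ≤ ∫ ω, |((stepCollection (G ω) N).weight
          (fun A => sizeAverage (s ∘ restrictSteps hM) A.card) : ℝ) -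
          limitGF s (samplePoint (stepCollection (G ω) N))| ∂μ := abs_integral_le_integral_abs
    _ ≤ ∫ ω, (2 ^ M * samplingError M N * T +
          {c : StepCollection N | T < sampleMass c}.indicator (fun _ => (1 : ℝ))
            (stepCollection (G ω) N)) ∂μ := by
        refine integral_mono (hi1.sub hi2).abs ((integrable_const _).add hi3) fun ω => ?_
        simp only
        by_cases hω : T < sampleMass (stepCollection (G ω) N)
        · rw [Set.indicator_of_mem (show stepCollection (G ω) N ∈ {c : StepCollection N | T < sampleMass c}
            from hω)]
          have h1 := hwI (stepCollection (G ω) N)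
          have h2 := hlI (stepCollection (G ω) N)
          have h3 : 0 ≤ 2 ^ M * samplingError M N * (T : ℝ) := by positivity
          rw [abs_le]
          constructor <;> linarith [h1.1, h1.2, h2.1, h2.2]
        · rw [Set.indicator_of_notMem
            (show stepCollection (G ω) N ∉ {c : StepCollection N | T < sampleMass c} from hω), add_zero]
          refine (abs_weight_sub_limitGF_le hs h0 hN1 hM _).trans ?_
          refine mul_le_mul_of_nonneg_left ?_ (by positivity)
          exact_mod_cast not_lt.1 hω
    _ = 2 ^ M * samplingError M N * T + μ.real {ω | T < sampleMass (stepCollection (G ω) N)} := by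
        rw [integral_add (integrable_const _) hi3, integral_indicator_stepCollection hm,
          integral_const]
        simp
    _ < δ := by linarith [hT N hN1]

end Limit

section Representation

variable {Ω W : Type*} [MeasurableSpace Ω] {μ : Measure Ω} [IsProbabilityMeasure μ]
  {G : Ω → GraphSeq W}

lemma isCompact_mass_le (T : ℝ≥0) : IsCompact {x : massSet | x.1.2 ≤ T} := by
  have h1 : IsCompact ((Set.univ : Set (ℕ → I)) ×ˢ Set.Icc (0 : ℝ≥0) T) :=
    isCompact_univ.prod isCompact_Icc
  have h2 := isClosed_massSet.isClosedEmbedding_subtypeVal.isCompact_preimage h1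
  convert h2 using 1
  ext x
  simp

/-- The generating functions of a graph sequence with an EGPF are mixtures. -/
theorem HasEGPF.exists_mixing_measure (h : HasEGPF μ G) :
    ∃ P : Measure massSet, IsProbabilityMeasure P ∧
      ∀ (M : ℕ) (s : Finset (Fin M) → ℝ≥0), (∀ A, s A ≤ 1) → s ∅ = 1 →
        ∫ x : massSet, limitGF s x ∂P = ∫ ω, ((stepCollection (G ω) M).weight s : ℝ) ∂μ := by
  have hm : ∀ N, AEMeasurable (fun ω => samplePoint (stepCollection (G ω) N)) μ := fun N =>
    (Measurable.of_discrete (f := samplePoint (N := N))).comp_aemeasurable (h.1.aemeasurable N)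
  let Q : ℕ → ProbabilityMeasure massSet := fun N =>
    ⟨μ.map fun ω => samplePoint (stepCollection (G ω) (N + 1)),
      Measure.isProbabilityMeasure_map (hm (N + 1))⟩
  have htight : IsTightMeasureSet
      {((ν : ProbabilityMeasure massSet) : Measure massSet) | ν ∈ Set.range Q} := by
    rw [isTightMeasureSet_iff_exists_isCompact_measure_compl_le]
    intro ε hε
    obtain ⟨δ, hδ0, hδ⟩ : ∃ δ : ℝ, 0 < δ ∧ ENNReal.ofReal δ ≤ ε := by
      rcases eq_or_ne ε ∞ with rfl | hε'
      · exact ⟨1, one_pos, le_top⟩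
      · exact ⟨ε.toReal, ENNReal.toReal_pos hε.ne' hε', (ENNReal.ofReal_toReal hε').le⟩
    obtain ⟨T, hT⟩ := h.exists_measureReal_sampleMass_le hδ0
    refine ⟨_, isCompact_mass_le T, ?_⟩
    rintro _ ⟨_, ⟨N, rfl⟩, rfl⟩
    have hmeas : MeasurableSet ({x : massSet | x.1.2 ≤ T}ᶜ) :=
      (isCompact_mass_le T).isClosed.measurableSet.compl
    simp only [Q, ProbabilityMeasure.coe_mk]
    rw [Measure.map_apply_of_aemeasurable (hm (N + 1)) hmeas]
    have hset : (fun ω => samplePoint (stepCollection (G ω) (N + 1))) ⁻¹'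
        {x : massSet | x.1.2 ≤ T}ᶜ =
        {ω | T < sampleMass (stepCollection (G ω) (N + 1))} := by
      ext ω
      simp [samplePoint]
    rw [hset, ← ofReal_measureReal]
    exact (ENNReal.ofReal_le_ofReal (hT (N + 1) (by omega))).trans hδ
  have hcomp := isCompact_closure_of_isTightMeasureSet htight
  obtain ⟨P, -, hP⟩ := hcomp.ultrafilter_le_nhds ((Filter.hyperfilter ℕ).map Q) (by
    rw [Filter.le_principal_iff, Ultrafilter.mem_coe, Ultrafilter.mem_map]
    exact Filter.Eventually.of_forall fun N => subset_closure ⟨N, rfl⟩)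
  have hPt : Filter.Tendsto Q (Filter.hyperfilter ℕ : Filter ℕ) (nhds P) := hP
  refine ⟨P, inferInstance, fun M s hs h0 => ?_⟩
  let F : BoundedContinuousFunction massSet ℝ :=
    BoundedContinuousFunction.ofNormedAddCommGroup (fun x : massSet => limitGF s x)
      (continuous_limitGF hs h0) 1 fun x => by
        have := limitGF_mem_Icc hs h0 x.2
        rw [Real.norm_eq_abs, abs_of_nonneg this.1]
        exact this.2
  have h1 := ProbabilityMeasure.tendsto_iff_forall_integral_tendsto.1 hPt F
  have h2 : ∀ N, ∫ x, F x ∂(Q N : Measure massSet) =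
      ∫ ω, limitGF s (samplePoint (stepCollection (G ω) (N + 1))) ∂μ := fun N =>
    integral_map (hm (N + 1)) F.continuous.aestronglyMeasurable
  simp only [h2] at h1
  have h3 := ((h.tendsto_integral_limitGF hs h0).comp (Filter.tendsto_add_atTop_nat 1)).mono_left
    Nat.hyperfilter_le_atTop
  exact tendsto_nhds_unique h1 h3

/-- The law of the sequence of step collections is determined by the generating functions. -/
theorem identDistrib_of_lintegral_weight {Ω' W' : Type*} [MeasurableSpace Ω'] {μ' : Measure Ω'}
    [IsProbabilityMeasure μ'] {G' : Ω' → GraphSeq W'}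
    (hm : ∀ N, AEMeasurable (fun ω => stepCollection (G ω) N) μ)
    (hm' : ∀ N, AEMeasurable (fun ω => stepCollection (G' ω) N) μ')
    (h : ∀ (N : ℕ) (s : Finset (Fin N) → ℝ≥0), (∀ A, s A ≤ 1) → s ∅ = 1 →
      ∫⁻ ω, (stepCollection (G ω) N).weight s ∂μ = ∫⁻ ω, (stepCollection (G' ω) N).weight s ∂μ') :
    IdentDistrib (fun ω (N : ℕ) => stepCollection (G ω) N)
      (fun ω (N : ℕ) => stepCollection (G' ω) N) μ μ' := by
  have hlaw : ∀ N, μ.map (fun ω => stepCollection (G ω) N) =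
      μ'.map (fun ω => stepCollection (G' ω) N) := by
    intro N
    have := Measure.isProbabilityMeasure_map (hm N)
    have := Measure.isProbabilityMeasure_map (hm' N)
    refine ext_of_lintegral_weight fun s hs => ?_
    rw [lintegral_map' Measurable.of_discrete.aemeasurable (hm N),
      lintegral_map' Measurable.of_discrete.aemeasurable (hm' N)]
    have hne : ∀ A : Finset (Fin N), A.Nonempty → s A = Function.update s ∅ 1 A := fun A hA => by
      simp [Function.update_of_ne hA.ne_empty]
    simp only [StepCollection.weight_congr hne fun A hA => nonempty_of_mem_stepCollection hA]
    refine h N _ (fun A => ?_) (by simp)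
    by_cases hA : A = ∅
    · simp [hA]
    · rw [Function.update_of_ne hA]
      exact hs A
  have hseq : AEMeasurable (fun ω (N : ℕ) => stepCollection (G ω) N) μ :=
    aemeasurable_pi_lambda _ hm
  have hseq' : AEMeasurable (fun ω (N : ℕ) => stepCollection (G' ω) N) μ' :=
    aemeasurable_pi_lambda _ hm'
  refine ⟨hseq, hseq', ?_⟩
  let P : (J : Finset ℕ) → Measure (∀ N : J, StepCollection N) := fun J =>
    (μ.map fun ω (N : ℕ) => stepCollection (G ω) N).map J.restrict
  have : IsProbabilityMeasure (μ.map fun ω (N : ℕ) => stepCollection (G ω) N) :=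
    Measure.isProbabilityMeasure_map hseq
  have hPfin : ∀ J, IsFiniteMeasure (P J) := fun J => by
    simp only [P]
    infer_instance
  refine IsProjectiveLimit.unique (P := P) (fun J => rfl) fun J => ?_
  simp only [P]
  have hJ : ∀ N : J, (N : ℕ) ≤ J.sup id := fun N => Finset.le_sup (f := id) N.2
  let R : StepCollection (J.sup id) → ∀ N : J, StepCollection N := fun c N => c.restrict (hJ N)
  have hR : Measurable R := Measurable.of_discrete
  have hfac : (J.restrict ∘ fun ω (N : ℕ) => stepCollection (G ω) N) =
        R ∘ fun ω => stepCollection (G ω) (J.sup id) := by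
    ext ω N : 2
    exact (stepCollection_restrict (G ω) (hJ N)).symm
  have hfac' : (J.restrict ∘ fun ω (N : ℕ) => stepCollection (G' ω) N) =
        R ∘ fun ω => stepCollection (G' ω) (J.sup id) := by
    ext ω N : 2
    exact (stepCollection_restrict (G' ω) (hJ N)).symm
  rw [AEMeasurable.map_map_of_aemeasurable (Finset.measurable_restrict J).aemeasurable hseq,
    AEMeasurable.map_map_of_aemeasurable (Finset.measurable_restrict J).aemeasurable hseq',
    hfac, hfac', ← AEMeasurable.map_map_of_aemeasurable hR.aemeasurable (hm _),
    ← AEMeasurable.map_map_of_aemeasurable hR.aemeasurable (hm' _), hlaw]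

lemma measurableSet_summable_freq :
    MeasurableSet {x : ℝ≥0 × (ℕ → I) | Summable fun k => (x.2 k : ℝ)} := by
  have hiff : ∀ x : ℝ≥0 × (ℕ → I), (Summable fun k => (x.2 k : ℝ)) ↔
      ∑' k, ENNReal.ofReal (x.2 k) ≠ ∞ := fun x => by
    refine ⟨fun h => ?_, fun h => ?_⟩
    · rw [← ENNReal.ofReal_tsum_of_nonneg (fun k => (x.2 k).2.1) h]
      exact ENNReal.ofReal_ne_top
    · exact (ENNReal.summable_toReal h).congr fun k => ENNReal.toReal_ofReal (x.2 k).2.1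
  simp only [hiff]
  have hm : Measurable fun x : ℝ≥0 × (ℕ → I) => ∑' k, ENNReal.ofReal (x.2 k) :=
    Measurable.tsum fun k => by fun_prop
  exact hm (MeasurableSet.singleton ∞).compl

theorem HasEGPF.exists_identDistrib (h : HasEGPF μ G) :
    ∃ (Ω' : Type) (_ : MeasurableSpace Ω') (μ' : Measure Ω') (lam : Ω' → ℝ≥0)
      (freq : Ω' → ℕ → I) (G' : Ω' → GraphSeq ℕ),
      IsProbabilityMeasure μ' ∧ IsFrequencyPoissonGraph μ' lam freq G' ∧
      IdentDistrib (fun ω (N : ℕ) => stepCollection (G ω) N)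
        (fun ω (N : ℕ) => stepCollection (G' ω) N) μ μ' := by
  obtain ⟨P, hPprob, hP⟩ := h.exists_mixing_measure
  let θ : massSet → ℝ≥0 × (ℕ → I) := fun x => (dust x, x.1.1)
  have hθ : Measurable θ :=
    (measurable_dust.comp measurable_subtype_coe).prodMk
      (measurable_fst.comp measurable_subtype_coe)
  have : IsProbabilityMeasure (P.map θ) := Measure.isProbabilityMeasure_map hθ.aemeasurable
  have hsum : ∀ᵐ x ∂(P.map θ), Summable fun k => (x.2 k : ℝ) := by
    rw [ae_map_iff hθ.aemeasurable measurableSet_summable_freq]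
    exact Filter.Eventually.of_forall fun x => summable_of_mem_massSet x.2
  obtain ⟨Ω', _, μ', lam, freq, G', hμ', hmap, hG'⟩ :=
    exists_isFrequencyPoissonGraph (P.map θ) hsum
  refine ⟨Ω', _, μ', lam, freq, G', hμ', hG', ?_⟩
  refine identDistrib_of_lintegral_weight h.1.aemeasurable hG'.aemeasurable fun N s hs h0 => ?_
  have hc := rateGF_nonneg hs
  let g : ℕ → ℝ≥0 × (ℕ → I) → ℝ≥0∞ := fun K x => ENNReal.ofReal
    (Real.exp (-(x.1 * rateGF s)) * ∏ k ∈ Finset.range K, edgeGF s (x.2 k))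
  have hg : ∀ K, Measurable (g K) := fun K => by
    have := (continuous_edgeGF s).measurable
    fun_prop
  have h1 := hG'.tendsto_lintegral_weight hs h0
  have h2 : ∀ K, ∫⁻ ω, g K (lam ω, freq ω) ∂μ' = ∫⁻ x, g K (θ x) ∂P := fun K => by
    rw [← lintegral_map (hg K) (hG'.measurable.1.prodMk hG'.measurable.2), hmap,
      lintegral_map (hg K) hθ]
  have h3 : Filter.Tendsto (fun K => ∫⁻ x, g K (θ x) ∂P) Filter.atTop
      (nhds (∫⁻ x : massSet, ENNReal.ofReal (limitGF s x) ∂P)) := by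
    refine tendsto_lintegral_of_dominated_convergence (fun _ => 1)
      (fun K => (hg K).comp hθ) (fun K => Filter.Eventually.of_forall fun x => ?_) (by simp)
      (Filter.Eventually.of_forall fun x => ?_)
    · rw [← ENNReal.ofReal_one]
      refine ENNReal.ofReal_le_ofReal (mul_le_one₀ ?_ ?_ ?_)
      · rw [Real.exp_le_one_iff, neg_nonpos]
        exact mul_nonneg (NNReal.coe_nonneg _) hc
      · exact Finset.prod_nonneg fun k _ => edgeGF_nonneg s (x.1.1 k).2.1 (x.1.1 k).2.2
      · exact Finset.prod_le_one (fun k _ => edgeGF_nonneg s (x.1.1 k).2.1 (x.1.1 k).2.2)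
          fun k _ => edgeGF_le_one hs (x.1.1 k).2.1 (x.1.1 k).2.2
    · exact (ENNReal.continuous_ofReal.tendsto _).comp (tendsto_dust_product hs h0 x.2)
  have h4 := tendsto_nhds_unique h1 (h3.congr fun K => (h2 K).symm)
  have hint : Integrable (fun x : massSet => limitGF s x) P :=
    integrable_of_mem_Icc (continuous_limitGF hs h0).aestronglyMeasurable
      fun x => limitGF_mem_Icc hs h0 x.2
  rw [h4, ← ofReal_integral_eq_lintegral_ofReal hint
    (Filter.Eventually.of_forall fun x => (limitGF_mem_Icc hs h0 x.2).1), hP N s hs h0,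
    ofReal_integral_eq_lintegral_ofReal
      (integrable_of_mem_Icc (aestronglyMeasurable_comp_stepCollection (h.1.aemeasurable N)
        fun c => (c.weight s : ℝ)) fun ω => coe_weight_mem_Icc hs _)
      (Filter.Eventually.of_forall fun ω => NNReal.coe_nonneg _)]
  simp only [ENNReal.ofReal_coe_nnreal]

end Representation

theorem theorem1 :
    -- every joint law of the rate and of summable frequencies is realized by the construction
    (∀ π : Measure (ℝ≥0 × (ℕ → I)), IsProbabilityMeasure π →
      (∀ᵐ x ∂π, Summable fun k => (x.2 k : ℝ)) →
      ∃ (Ω : Type) (_ : MeasurableSpace Ω) (μ : Measure Ω) (lam : Ω → ℝ≥0) (freq : Ω → ℕ → I)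
        (G : Ω → GraphSeq ℕ),
        IsProbabilityMeasure μ ∧ μ.map (fun ω => (lam ω, freq ω)) = π ∧
        IsFrequencyPoissonGraph μ lam freq G) ∧
    -- every graph generated by the construction is edge-exchangeable and has an EGPF
    (∀ (Ω : Type*) (W : Type*) [MeasurableSpace Ω] (μ : Measure Ω) [IsProbabilityMeasure μ]
      (lam : Ω → ℝ≥0) (freq : Ω → ℕ → I) (G : Ω → GraphSeq W),
      IsFrequencyPoissonGraph μ lam freq G → IsEdgeExchangeable μ G ∧ HasEGPF μ G) ∧
    -- every graph with an EGPF has the same law as one generated by the construction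
    (∀ (Ω : Type*) (W : Type*) [MeasurableSpace Ω] (μ : Measure Ω) [IsProbabilityMeasure μ]
      (G : Ω → GraphSeq W), HasEGPF μ G →
      ∃ (Ω' : Type) (_ : MeasurableSpace Ω') (μ' : Measure Ω') (lam : Ω' → ℝ≥0)
        (freq : Ω' → ℕ → I) (G' : Ω' → GraphSeq ℕ),
        IsProbabilityMeasure μ' ∧ IsFrequencyPoissonGraph μ' lam freq G' ∧
        IdentDistrib (fun ω (N : ℕ) => stepCollection (G ω) N)
          (fun ω (N : ℕ) => stepCollection (G' ω) N) μ μ') := by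
  refine ⟨fun π _ hπ => exists_isFrequencyPoissonGraph π hπ, ?_, ?_⟩
  · intro Ω W _ μ _ lam freq G h
    exact ⟨h.hasEGPF.1, h.hasEGPF⟩
  · intro Ω W _ μ _ G h
    exact h.exists_identDistrib
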